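/- Let $N\ge 1$, let $a,h\in\mathbb R$ with $h\neq 0$, let $a_{1d},\dots,a_{Nd}\in\mathbb R$ be not all zero, and put $$\Delta(s)=s-a-\sum_{j=1}^N a_{jd}\,e^{-jsh}\qquad(s\in\mathbb C).$$ Assume that all zeros of $\Delta$ (the characteristic roots) are simple. For $k\in\mathbb Z$ let $W_k$ be the $k$-th branch of the Lambert $W$ function (the inverse branches of $w\mapsto we^w$ with the standard branch cuts, $W_0(0)=0$, and $W_k(0)$ undefined for $k\ne0$), and put $$\Lambda(s)=\sum_{j=1}^N a_{jd}\,h\,e^{-jah}\,e^{-(j-1)(s-a)h}.$$ Then the zeros of $\Delta$ can be enumerated without repetition as $(S_n)_{n\in\mathbb Z}$, and for every such enumeration the following hold. 1. For every $n$, the number $(S_n-a)h$ lies in the range of some branch $W_k$, and for each such $k$ $$S_n=\frac1h\,W_k\bigl(\Lambda(S_n)\bigr)+a .$$ Conversely, if $z\in\mathbb C$ and $k\in\mathbb Z$ satisfy $z=\frac1h W_k(\Lambda(z))+a$ (where $W_k(\Lambda(z))$ is defined, i.e. $k=0$ or $\Lambda(z)\ne0$), then $z=S_n$ for some $n$. 2.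 For every $n$, $1+\sum_{j=1}^N j\,a_{jd}\,h\,e^{-jS_nh}\neq0$, and $$C_n=\frac{1}{1+\sum_{j=1}^N j\,a_{jd}\,h\,e^{-jS_nh}}=\lim_{s\to S_n}\frac{s-S_n}{\Delta(s)}$$ is the residue of $1/\Delta$ at $S_n$. 3. For every $s\in\mathbb C$ with $\Delta(s)\ne0$, $$\frac1{\Delta(s)}=\sum_{n\in\mathbb Z}\frac{C_n}{s-S_n},$$ where the series converges absolutely. -/

import Mathlib

open Filter Topology

noncomputable section

namespace MultiDelay

/-- The characteristic function `Δ(s) = s - a - ∑_{j=1}^N a_{jd} e^{-j s h}`;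
`A j` is the coefficient `a_{jd}`, only the values for `1 ≤ j ≤ N` being used. -/
def charFn (N : ℕ) (a : ℝ) (A : ℕ → ℝ) (h : ℝ) (s : ℂ) : ℂ :=
  s - a - ∑ j ∈ Finset.Icc 1 N, (A j : ℂ) * Complex.exp (-(j : ℂ) * s * h)

/-- The quantity `1 + ∑_{j=1}^N j a_{jd} h e^{-j S h}`. -/
def coeffDenom (N : ℕ) (A : ℕ → ℝ) (h : ℝ) (S : ℂ) : ℂ :=
  1 + ∑ j ∈ Finset.Icc 1 N, (j : ℂ) * (A j : ℂ) * h * Complex.exp (-(j : ℂ) * S * h)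

/-- The coefficient `C = 1 / (1 + ∑_{j=1}^N j a_{jd} h e^{-j S h})` that belongs to the root `S`. -/
def coeff (N : ℕ) (A : ℕ → ℝ) (h : ℝ) (S : ℂ) : ℂ :=
  1 / coeffDenom N A h S

/-- The range of the `k`-th branch of the Lambert W function (standard convention:
the branch cuts in the `z`-plane are `(-∞, -1/e)` for `k = 0` and `(-∞, 0]` for `k ≠ 0`, and every
branch is continuous onto its cut from above).

Up to the real half line `(-∞, -1]`, the range of the `k`-th branch is
the set of `w` for which the continuous argument `Im w + arg w` of `w e^w` is in
`((2k-1)π, (2k+1)π]`; the bounding curves are the curves `w = -η cot η + iη`. The half line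
`(-∞, -1]` is the real part of the range of the branch `k = -1`; its end point `-1`, the common value
of `W₀` and `W₋₁` at `-1/e`, belongs to the range of the branch `k = 0` too. -/
def lambertRange (k : ℤ) : Set ℂ :=
  {w | ((2 * (k : ℝ) - 1) * Real.pi < w.im + w.arg ∧
          w.im + w.arg ≤ (2 * (k : ℝ) + 1) * Real.pi ∧ ¬ (w.im = 0 ∧ w.re < -1)) ∨
        (k = -1 ∧ w.im = 0 ∧ w.re ≤ -1)}

open Classical in
/-- The `k`-th branch `W_k` of the Lambert W function: `W_k z` is the solution `w` of `w e^w = z` in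
the range of the `k`-th branch. (There is exactly one, except that there is none if `z = 0`
and `k ≠ 0`; the value there is a placeholder.) -/
def lambertW (k : ℤ) (z : ℂ) : ℂ :=
  if hz : ∃ w ∈ lambertRange k, w * Complex.exp w = z then hz.choose else 0

/-- The argument `∑_{j=1}^N a_{jd} h e^{-j a h} e^{-(j-1)(s-a)h}` of the Lambert W function
in the equation for the characteristic roots. -/
def lambertArg (N : ℕ) (a : ℝ) (A : ℕ → ℝ) (h : ℝ) (s : ℂ) : ℂ :=
  ∑ j ∈ Finset.Icc 1 N, (A j : ℂ) * h * Complex.exp (-(j : ℂ) * a * h) *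
    Complex.exp (-((j : ℂ) - 1) * (s - a) * h)

end MultiDelay

end

noncomputable section

namespace MultiDelay

/-! With `w = (s - a) h`, the function `h Δ` becomes `G(w) = w - p(e^{-w})`, where `p` is a
polynomial of degree `m ≥ 1`, and everything is proved for `G`.

Expansion: zeros of `G` have `|v| = O(1 + |e^{-v}|^m)`, while far to the left `G'` is at least of
order `|e^{-w}|^m`; hence `1/G'(v) = O(1/(1+|v|))` (`exists_norm_inv_quasiPolyDeriv_le`). Far to the
left the zeros have imaginary parts more than `1/m` apart, and only finitely many lie elsewhere
(`exists_zero_separation`, `finite_zeroSet_re_gt`). So the residue series converges absolutely, and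
it tends to `0` at infinity along the set where `|G|` is comparable to `1 + |e^{-w}|^m`. That set
contains the boundaries of arbitrarily large rectangles (`exists_good_rectangle`), and `1/G` tends
to `0` on it too. The difference of `1/G` and its series is entire, so the maximum principle makes
it zero (`remainder_eq_zero`).

With finitely many zeros the expansion would force `w/G(w)` to have one limit at infinity; it tends
to `1` along the positive and to `0` along the negative reals (`infinite_zeroSet`). Hence an
enumeration by `ℤ` exists.

Lambert part: `Δ(s) = 0` is equivalent to `w e^w = Λ(s)`. It remains that `w ↦ w e^w` is injective
on each branch range and hits every nonzero number there (`injOn_mul_exp_lambertRange`,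
`exists_lambertRange_mul_exp_eq`). -/

/-! ### Polynomial growth and an injectivity criterion -/

open Polynomial in
theorem exists_norm_eval_sub_leading_le (r : ℂ[X]) {m : ℕ} (hr : r.natDegree ≤ m) {ε : ℝ}
    (hε : 0 < ε) :
    ∃ K : ℝ, 0 ≤ K ∧ ∀ u : ℂ, ‖r.eval u - r.coeff m * u ^ m‖ ≤ ε * ‖u‖ ^ m + K := by
  have mono : ∀ i ∈ Finset.range m, ∃ K : ℝ, 0 ≤ K ∧
      ∀ u : ℂ, ‖r.coeff i * u ^ i‖ ≤ ε / (m + 1) * ‖u‖ ^ m + K := by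
    intro i hi
    have him : i < m := Finset.mem_range.1 hi
    set c := ‖r.coeff i‖
    have hc : 0 ≤ c := norm_nonneg _
    set η := ε / (m + 1)
    have hη : 0 < η := by positivity
    -- Beyond this radius `c ≤ η |u|`, and one spare power of `|u|` absorbs the coefficient; inside
    -- it the monomial is bounded.
    set T := max 1 (c / η)
    refine ⟨c * T ^ i, by positivity, fun u => ?_⟩
    rw [norm_mul, norm_pow]
    have hu : 0 ≤ ‖u‖ := norm_nonneg u
    rcases le_total ‖u‖ T with h | h
    · have : c * ‖u‖ ^ i ≤ c * T ^ i := by gcongr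
      have : 0 ≤ η * ‖u‖ ^ m := by positivity
      linarith
    · have h1 : 1 ≤ ‖u‖ := (le_max_left _ _).trans h
      have h2 : c ≤ η * ‖u‖ := by
        have : c / η ≤ ‖u‖ := (le_max_right _ _).trans h
        rw [div_le_iff₀ hη] at this
        linarith
      have h3 : c * ‖u‖ ^ i ≤ η * ‖u‖ ^ m := calc
        c * ‖u‖ ^ i ≤ η * ‖u‖ * ‖u‖ ^ i := by gcongr
        _ = η * ‖u‖ ^ (i + 1) := by ring
        _ ≤ η * ‖u‖ ^ m := by gcongr; exact him
      have : 0 ≤ c * T ^ i := by positivity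
      linarith
  choose! K hK0 hK using mono
  refine ⟨∑ i ∈ Finset.range m, K i, Finset.sum_nonneg hK0, fun u => ?_⟩
  rw [eval_eq_sum_range' (Nat.lt_succ_of_le hr), Finset.sum_range_succ, add_sub_cancel_right]
  refine (norm_sum_le _ _).trans ((Finset.sum_le_sum fun i hi => hK i hi u).trans ?_)
  rw [Finset.sum_add_distrib, Finset.sum_const, Finset.card_range, nsmul_eq_mul]
  have h1 : (m : ℝ) * (ε / (m + 1) * ‖u‖ ^ m) ≤ ε * ‖u‖ ^ m := by
    rw [← mul_assoc]
    gcongr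
    rw [mul_div_assoc', div_le_iff₀ (by positivity)]
    nlinarith
  linarith

open Polynomial in
theorem exists_norm_eval_le (r : ℂ[X]) {m : ℕ} (hr : r.natDegree ≤ m) :
    ∃ K : ℝ, 0 < K ∧ ∀ u : ℂ, ‖r.eval u‖ ≤ K * (1 + ‖u‖ ^ m) := by
  obtain ⟨K, hK0, hK⟩ := exists_norm_eval_sub_leading_le r hr one_pos
  refine ⟨1 + ‖r.coeff m‖ + K, by positivity, fun u => ?_⟩
  have h1 := norm_le_norm_sub_add (r.eval u) (r.coeff m * u ^ m)
  have h2 := hK u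
  rw [norm_mul, norm_pow] at h1
  have : 0 ≤ ‖u‖ ^ m := by positivity
  have : 0 ≤ K * ‖u‖ ^ m := by positivity
  have : 0 ≤ ‖r.coeff m‖ := norm_nonneg _
  nlinarith

/-- A function whose derivative, up to a constant factor, has positive real part on a convex set
is injective there. -/
theorem injOn_of_re_deriv_pos {f f' : ℂ → ℂ} {s : Set ℂ} (hs : Convex ℝ s)
    (hf : ∀ z ∈ s, HasDerivAt f (f' z) z) (c : ℂ) (hpos : ∀ z ∈ s, 0 < (c * f' z).re) :
    Set.InjOn f s := by
  intro x hx y hy hxy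
  by_contra hne
  have hd : y - x ≠ 0 := sub_ne_zero.2 (Ne.symm hne)
  have hmem : ∀ t ∈ Set.Icc (0 : ℝ) 1, x + t * (y - x) ∈ s := by
    intro t ht
    have := hs.add_smul_sub_mem hx hy ht
    simpa using this
  -- Rolle on the segment: after division by `y - x`, the derivative of this real function is the
  -- real part assumed positive.
  have hder : ∀ t ∈ Set.Icc (0 : ℝ) 1, HasDerivAt
      (fun t : ℝ => (c * f (x + t * (y - x)) / (y - x)).re) (c * f' (x + t * (y - x))).re t := by
    intro t ht
    have h1 : HasDerivAt (fun z : ℂ => x + z * (y - x)) (y - x) (t : ℂ) := by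
      simpa using ((hasDerivAt_id (t : ℂ)).mul_const (y - x)).const_add x
    have h2 := ((((hf _ (hmem t ht)).comp (t : ℂ) h1).const_mul c).div_const (y - x))
    have h3 := h2.real_of_complex
    convert h3 using 1
    congr 1
    field_simp
  obtain ⟨t, ht, h0⟩ := exists_hasDerivAt_eq_zero (f := fun t : ℝ =>
      (c * f (x + t * (y - x)) / (y - x)).re) (zero_lt_one)
    (fun t ht => (hder t ht).continuousAt.continuousWithinAt) (by simp [hxy])
    (fun t ht => hder t (Set.Ioo_subset_Icc_self ht))
  exact absurd h0 (hpos _ (hmem t (Set.Ioo_subset_Icc_self ht))).ne'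

/-! ### The quasi-polynomial, its derivative and its growth scale -/

open Polynomial in
/-- The quasi-polynomial `w - p(e^{-w})`. -/
def quasiPoly (p : ℂ[X]) (w : ℂ) : ℂ := w - p.eval (Complex.exp (-w))

open Polynomial in
/-- The derivative of `quasiPoly p`. -/
def quasiPolyDeriv (p : ℂ[X]) (w : ℂ) : ℂ := 1 + (X * derivative p).eval (Complex.exp (-w))

open Polynomial

theorem hasDerivAt_quasiPoly (p : ℂ[X]) (w : ℂ) :
    HasDerivAt (quasiPoly p) (quasiPolyDeriv p w) w := by
  have h1 : HasDerivAt (fun w : ℂ => Complex.exp (-w)) (-Complex.exp (-w)) w := by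
    simpa using (hasDerivAt_neg w).cexp
  have h2 := (hasDerivAt_id w).sub ((p.hasDerivAt (Complex.exp (-w))).comp w h1)
  refine h2.congr_deriv ?_
  simp [quasiPolyDeriv]
  ring

theorem differentiable_quasiPoly (p : ℂ[X]) : Differentiable ℂ (quasiPoly p) :=
  fun w => (hasDerivAt_quasiPoly p w).differentiableAt

theorem natDegree_X_mul_derivative_le (p : ℂ[X]) (hp : 1 ≤ p.natDegree) :
    (X * derivative p).natDegree ≤ p.natDegree := by
  refine natDegree_mul_le.trans ?_
  have := natDegree_derivative_le p
  rw [natDegree_X]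
  omega

theorem coeff_X_mul_derivative (p : ℂ[X]) (hp : 1 ≤ p.natDegree) :
    (X * derivative p).coeff p.natDegree = p.natDegree * p.leadingCoeff := by
  obtain ⟨m, hm⟩ : ∃ m, p.natDegree = m + 1 := ⟨p.natDegree - 1, by omega⟩
  rw [leadingCoeff, hm, coeff_X_mul, coeff_derivative]
  push_cast
  ring

theorem norm_leadingCoeff_pos (p : ℂ[X]) (hp : 1 ≤ p.natDegree) : 0 < ‖p.leadingCoeff‖ := by
  rw [norm_pos_iff, leadingCoeff_ne_zero]
  rintro rfl
  simp at hp

/-- The growth scale `|e^{-w}|^m` of `quasiPoly p`, with `m` the degree of `p`. -/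
def scale (p : ℂ[X]) (w : ℂ) : ℝ := ‖Complex.exp (-w)‖ ^ p.natDegree

theorem scale_eq (p : ℂ[X]) (w : ℂ) : scale p w = Real.exp (-(p.natDegree * w.re)) := by
  rw [scale, Complex.norm_exp, ← Real.exp_nat_mul]
  simp

theorem scale_pos (p : ℂ[X]) (w : ℂ) : 0 < scale p w := by
  rw [scale_eq]; exact Real.exp_pos _

theorem le_scale (p : ℂ[X]) (hp : 1 ≤ p.natDegree) {U : ℝ} (hU : 0 ≤ U) {w : ℂ} (hw : w.re ≤ -U) :
    U ≤ scale p w := by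
  rw [scale_eq]
  have h1 : (1 : ℝ) ≤ p.natDegree := by exact_mod_cast hp
  have h2 : U ≤ -(p.natDegree * w.re) := by nlinarith
  have := Real.add_one_le_exp (-(p.natDegree * w.re))
  linarith

theorem exists_norm_quasiPolyDeriv_le (p : ℂ[X]) (hp : 1 ≤ p.natDegree) :
    ∃ K : ℝ, 0 < K ∧ ∀ w, ‖quasiPolyDeriv p w‖ ≤ K * (1 + scale p w) := by
  obtain ⟨K, hK0, hK⟩ := exists_norm_eval_le _ (natDegree_X_mul_derivative_le p hp)
  refine ⟨1 + K, by positivity, fun w => ?_⟩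
  have h1 := hK (Complex.exp (-w))
  have h2 := norm_add_le (1 : ℂ) ((X * derivative p).eval (Complex.exp (-w)))
  rw [norm_one] at h2
  have := scale_pos p w
  change _ ≤ K * (1 + scale p w) at h1
  unfold quasiPolyDeriv
  nlinarith

theorem exists_norm_sub_quasiPoly_le (p : ℂ[X]) :
    ∃ K : ℝ, 0 < K ∧ ∀ w, ‖w - quasiPoly p w‖ ≤ K * (1 + scale p w) := by
  obtain ⟨K, hK0, hK⟩ := exists_norm_eval_le p le_rfl
  refine ⟨K, hK0, fun w => ?_⟩
  simpa [quasiPoly, scale] using hK (Complex.exp (-w))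

/-- `e^{-mw} = |e^{-mw}| e^{-im Im w}`. -/
theorem exp_pow_eq (p : ℂ[X]) (w : ℂ) :
    Complex.exp (-w) ^ p.natDegree =
      scale p w * Complex.exp (-(p.natDegree * w.im * Complex.I)) := by
  rw [scale_eq, ← Complex.exp_nat_mul, Complex.ofReal_exp, ← Complex.exp_add]
  congr 1
  apply Complex.ext <;> simp

/-- Far to the left the derivative of `quasiPoly p` has nearly constant direction on lines
parallel to the real axis. -/
theorem exists_le_re_quasiPolyDeriv (p : ℂ[X]) (hp : 1 ≤ p.natDegree) :
    ∃ X₀ c : ℝ, 0 < X₀ ∧ 0 < c ∧ ∀ (y₀ : ℝ) (w : ℂ), w.re ≤ -X₀ →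
      |w.im - y₀| ≤ 1 / p.natDegree →
      c * scale p w ≤ (star p.leadingCoeff * Complex.exp (p.natDegree * y₀ * Complex.I) *
        quasiPolyDeriv p w).re := by
  set m := p.natDegree with hm
  set b := p.leadingCoeff with hb
  have hm0 : (0 : ℝ) < m := by exact_mod_cast hp
  have hb0 : 0 < ‖b‖ := norm_leadingCoeff_pos p hp
  obtain ⟨K, hK0, hK⟩ := exists_norm_eval_sub_leading_le (X * derivative p)
    (natDegree_X_mul_derivative_le p hp) (ε := m * ‖b‖ / 4) (by positivity)
  rw [coeff_X_mul_derivative p hp, ← hm, ← hb] at hK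
  -- In units of `m ‖b‖² t`: the main term gives `1/2`, the lower-order terms cost `1/4`, and `1 +
  -- K` costs `1/8` because `t` is large; `1/8` remains.
  refine ⟨8 * (1 + K) / (m * ‖b‖), m * ‖b‖ ^ 2 / 8, by positivity, by positivity, ?_⟩
  intro y₀ w hw hy
  set t := scale p w with ht
  have ht0 : 0 < t := scale_pos p w
  have ht1 : 8 * (1 + K) / (m * ‖b‖) ≤ t := le_scale p hp (by positivity) hw
  rw [div_le_iff₀ (by positivity)] at ht1
  set u := Complex.exp (-w) with hu
  set R := (X * derivative p).eval u - m * b * u ^ m with hR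
  have hR1 : ‖1 + R‖ ≤ 1 + (m * ‖b‖ / 4 * t + K) := by
    refine (norm_add_le _ _).trans ?_
    rw [norm_one]
    gcongr
    exact hK u
  -- This factor cancels the phase of the leading term of the derivative on the line `Im w = y₀`.
  -- Within distance `1/m` of that line the phase error is at most `1`, so its cosine is at least
  -- `1/2`.
  set d := star b * Complex.exp (m * y₀ * Complex.I) with hd
  have hdn : ‖d‖ = ‖b‖ := by
    rw [hd, norm_mul, norm_star]
    have : ((m : ℂ) * y₀ * Complex.I) = ((m * y₀ : ℝ) : ℂ) * Complex.I := by push_cast; ring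
    rw [this, Complex.norm_exp_ofReal_mul_I, mul_one]
  have hsplit : d * quasiPolyDeriv p w = d * (m * b * u ^ m) + d * (1 + R) := by
    rw [quasiPolyDeriv, hR]; ring
  have hmain : d * (m * b * u ^ m) =
      ((m * ‖b‖ ^ 2 * t : ℝ) : ℂ) * Complex.exp (((m * (y₀ - w.im) : ℝ) : ℂ) * Complex.I) := by
    have hbb : star b * b = ((‖b‖ ^ 2 : ℝ) : ℂ) := by
      rw [Complex.star_def, Complex.conj_mul']; push_cast; rfl
    rw [hd, hu, hm, exp_pow_eq, ← hm, ← ht]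
    calc star b * Complex.exp (m * y₀ * Complex.I) *
          (m * b * (t * Complex.exp (-(m * w.im * Complex.I))))
        = (star b * b) * m * t * (Complex.exp (m * y₀ * Complex.I) *
          Complex.exp (-(m * w.im * Complex.I))) := by ring
      _ = _ := by
        rw [hbb, ← Complex.exp_add]
        push_cast
        ring_nf
  have hcos : 1 / 2 ≤ Real.cos (m * (y₀ - w.im)) := by
    have h1 := Real.one_sub_sq_div_two_le_cos (x := m * (y₀ - w.im))
    have h2 : |m * (y₀ - w.im)| ≤ 1 := by
      rw [abs_mul, abs_of_pos hm0, abs_sub_comm]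
      rw [le_div_iff₀ hm0] at hy
      linarith
    have h3 : (m * (y₀ - w.im)) ^ 2 ≤ 1 := (sq_le_one_iff_abs_le_one _).2 h2
    linarith
  have hre1 : (d * (m * b * u ^ m)).re = m * ‖b‖ ^ 2 * t * Real.cos (m * (y₀ - w.im)) := by
    rw [hmain, Complex.re_ofReal_mul, Complex.exp_ofReal_mul_I_re]
  have hre2 : -(‖b‖ * (1 + (m * ‖b‖ / 4 * t + K))) ≤ (d * (1 + R)).re := by
    have h1 := (abs_le.1 (Complex.abs_re_le_norm (d * (1 + R)))).1
    rw [norm_mul, hdn] at h1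
    have := mul_le_mul_of_nonneg_left hR1 hb0.le
    linarith
  rw [hsplit, Complex.add_re, hre1]
  have h5 : m * ‖b‖ ^ 2 * t * (1 / 2) ≤ m * ‖b‖ ^ 2 * t * Real.cos (m * (y₀ - w.im)) := by
    gcongr
  have h6 := mul_le_mul_of_nonneg_left ht1 hb0.le
  nlinarith

/-! ### Distribution of the zeros and size of the residues -/

theorem summable_one_div_one_add_abs_sq :
    Summable fun k : ℤ => 1 / (1 + |(k : ℝ)|) ^ 2 := by
  have h := (Real.summable_one_div_int_pow (p := 2)).2 one_lt_two
  refine Summable.of_norm_bounded_eventually h ?_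
  rw [Filter.eventually_cofinite]
  refine (Set.finite_singleton (0 : ℤ)).subset fun k hk => ?_
  by_contra hk0
  apply hk
  have hk1 : 0 < |(k : ℝ)| := abs_pos.2 (by exact_mod_cast hk0)
  rw [Real.norm_of_nonneg (by positivity), ← sq_abs (k : ℝ)]
  gcongr
  linarith

/-- Rounding `y i / δ` down is injective on separated points, so the sum is dominated by one over
`ℤ`. Shifting by the rounded `t / δ` makes the bound independent of `t`. -/
theorem sum_one_div_one_add_abs_sub_sq_le {ι : Type*} (S : Finset ι) (y : ι → ℝ) {δ : ℝ}
    (hδ : 0 < δ) (hδ1 : δ ≤ 1) (hy : ∀ i ∈ S, ∀ j ∈ S, |y i - y j| ≤ δ → i = j) (t : ℝ) :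
    ∑ i ∈ S, 1 / (1 + |t - y i|) ^ 2 ≤ 4 / δ ^ 2 * ∑' k : ℤ, 1 / (1 + |(k : ℝ)|) ^ 2 := by
  classical
  set g : ι → ℤ := fun i => ⌊y i / δ⌋ - ⌊t / δ⌋ with hg
  have hinj : Set.InjOn g S := by
    intro i hi j hj hij
    apply hy i hi j hj
    have h1 : ⌊y i / δ⌋ = ⌊y j / δ⌋ := by simpa [hg] using hij
    have h2 := Int.abs_sub_lt_one_of_floor_eq_floor h1
    rw [← sub_div, abs_div, abs_of_pos hδ, div_lt_one hδ] at h2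
    exact h2.le
  have hle : ∀ i ∈ S, 1 / (1 + |t - y i|) ^ 2 ≤ 4 / δ ^ 2 * (1 / (1 + |(g i : ℝ)|) ^ 2) := by
    intro i _
    have h1 : δ / 2 * (1 + |(g i : ℝ)|) ≤ 1 + |t - y i| := by
      have e1 := Int.floor_le (y i / δ)
      have e2 := Int.lt_floor_add_one (y i / δ)
      have e3 := Int.floor_le (t / δ)
      have e4 := Int.lt_floor_add_one (t / δ)
      have h3 : |(g i : ℝ)| ≤ |t - y i| / δ + 1 := by
        have : |t - y i| / δ = |y i / δ - t / δ| := by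
          rw [← sub_div, abs_div, abs_of_pos hδ, abs_sub_comm]
        rw [this, hg]
        push_cast
        have a1 := le_abs_self (y i / δ - t / δ)
        have a2 := neg_abs_le (y i / δ - t / δ)
        rw [abs_le]
        constructor <;> linarith
      have h4 := mul_le_mul_of_nonneg_left h3 hδ.le
      have h5 : δ * (|t - y i| / δ + 1) = |t - y i| + δ := by field_simp
      have := abs_nonneg (t - y i)
      linarith
    have h6 : 4 / δ ^ 2 * (1 / (1 + |(g i : ℝ)|) ^ 2) = 1 / (δ / 2 * (1 + |(g i : ℝ)|)) ^ 2 := by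
      field_simp
      norm_num
    rw [h6]
    gcongr
  refine (Finset.sum_le_sum hle).trans ?_
  rw [← Finset.mul_sum]
  gcongr
  rw [← Finset.sum_image (f := fun k : ℤ => 1 / (1 + |(k : ℝ)|) ^ 2) hinj]
  exact summable_one_div_one_add_abs_sq.sum_le_tsum _ fun k _ => by positivity

/-- The set of zeros of `quasiPoly p`. -/
def zeroSet (p : ℂ[X]) : Set ℂ := {z | quasiPoly p z = 0}

/-- All zeros of `quasiPoly p` are simple. -/
def SimpleZeros (p : ℂ[X]) : Prop := ∀ z ∈ zeroSet p, quasiPolyDeriv p z ≠ 0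

theorem finite_zeroSet_inter_closedBall {p : ℂ[X]} (hs : SimpleZeros p) (R : ℝ) :
    (zeroSet p ∩ Metric.closedBall 0 R).Finite := by
  apply IsCompact.finite
  · exact (isCompact_closedBall 0 R).inter_left
      (isClosed_eq (differentiable_quasiPoly p).continuous continuous_const)
  · rw [isDiscrete_iff_discreteTopology, discreteTopology_subtype_iff]
    intro x hx
    rw [← _root_.disjoint_iff, Filter.disjoint_principal_right]
    filter_upwards [(hasDerivAt_quasiPoly p x).eventually_ne (c := 0) (hs x hx.1)] with z hz hz'
    exact hz hz'.1

theorem norm_le_of_mem_zeroSet {p : ℂ[X]} {K : ℝ}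
    (hK : ∀ w, ‖w - quasiPoly p w‖ ≤ K * (1 + scale p w)) {z : ℂ} (hz : z ∈ zeroSet p) :
    ‖z‖ ≤ K * (1 + scale p z) := by
  have := hK z
  rwa [show quasiPoly p z = 0 from hz, sub_zero] at this

/-- To the right of a vertical line the scale is bounded, and a zero satisfies `z = p(e^{-z})`; so
these zeros lie in a disc, where there are finitely many by isolation. -/
theorem finite_zeroSet_re_gt {p : ℂ[X]} (hs : SimpleZeros p) (X₀ : ℝ) :
    {z ∈ zeroSet p | -X₀ < z.re}.Finite := by
  obtain ⟨K, hK0, hK⟩ := exists_norm_sub_quasiPoly_le p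
  refine (finite_zeroSet_inter_closedBall hs
    (K * (1 + Real.exp (p.natDegree * X₀)))).subset fun z hz => ⟨hz.1, ?_⟩
  rw [mem_closedBall_zero_iff]
  refine (norm_le_of_mem_zeroSet hK hz.1).trans ?_
  rw [scale_eq]
  gcongr
  have := hz.2
  have h1 : (0 : ℝ) ≤ p.natDegree := Nat.cast_nonneg _
  nlinarith

theorem convex_halfStrip (X₀ y₀ δ : ℝ) : Convex ℝ {w : ℂ | w.re ≤ -X₀ ∧ |w.im - y₀| ≤ δ} := by
  have h1 : Convex ℝ {w : ℂ | w.re ≤ -X₀} := convex_halfSpace_re_le _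
  have h2 : Convex ℝ {w : ℂ | y₀ - δ ≤ w.im} := convex_halfSpace_im_ge _
  have h3 : Convex ℝ {w : ℂ | w.im ≤ y₀ + δ} := convex_halfSpace_im_le _
  convert h1.inter (h2.inter h3) using 1
  ext w
  simp only [Set.mem_ofPred_eq, Set.mem_inter_iff, abs_le]
  constructor <;> rintro ⟨h1, h2, h3⟩ <;> refine ⟨h1, ?_, ?_⟩ <;> linarith

/-- On a half strip of half-width `1/m` far to the left, a fixed multiple of the derivative has
positive real part, so the function is injective there and vanishes at most once. -/
theorem exists_zero_separation (p : ℂ[X]) (hp : 1 ≤ p.natDegree) :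
    ∃ X₀ c : ℝ, 0 < X₀ ∧ 0 < c ∧
      (∀ v ∈ zeroSet p, ∀ w ∈ zeroSet p, v.re ≤ -X₀ → w.re ≤ -X₀ →
        |v.im - w.im| ≤ 1 / p.natDegree → v = w) ∧
      ∀ w : ℂ, w.re ≤ -X₀ → c * scale p w ≤ ‖quasiPolyDeriv p w‖ := by
  obtain ⟨X₀, c, hX, hc, H⟩ := exists_le_re_quasiPolyDeriv p hp
  have hb := norm_leadingCoeff_pos p hp
  refine ⟨X₀, c / ‖p.leadingCoeff‖, hX, by positivity, ?_, ?_⟩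
  · intro v hv w hw hvX hwX hvw
    refine injOn_of_re_deriv_pos (convex_halfStrip X₀ w.im (1 / p.natDegree))
      (fun z _ => hasDerivAt_quasiPoly p z) _
      (fun z hz => lt_of_lt_of_le ?_ (H w.im z hz.1 hz.2)) ⟨hvX, hvw⟩ ⟨hwX, by simp⟩ ?_
    · exact mul_pos hc (scale_pos p z)
    · rw [show quasiPoly p v = 0 from hv, show quasiPoly p w = 0 from hw]
  · intro w hw
    have h1 := (H w.im w hw (by simp)).trans (Complex.re_le_norm _)
    rw [norm_mul, norm_mul, norm_star] at h1
    have : ((p.natDegree : ℂ) * w.im * Complex.I) =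
      ((p.natDegree * w.im : ℝ) : ℂ) * Complex.I := by push_cast; ring
    rw [this, Complex.norm_exp_ofReal_mul_I, mul_one] at h1
    rw [div_mul_eq_mul_div, div_le_iff₀ hb]
    linarith

/-- The separated zeros on the left are controlled by comparison with `ℤ`; each of the finitely many
others contributes at most `1`. -/
theorem exists_sum_zeroSet_le {p : ℂ[X]} (hp : 1 ≤ p.natDegree) (hs : SimpleZeros p) :
    ∃ M : ℝ, 0 < M ∧ ∀ (t : ℝ) (S : Finset (zeroSet p)),
      ∑ v ∈ S, 1 / (1 + |t - (v : ℂ).im|) ^ 2 ≤ M := by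
  classical
  obtain ⟨X₀, c, hX, hc, hsep, -⟩ := exists_zero_separation p hp
  have hfin := finite_zeroSet_re_gt hs X₀
  have hm : (1 : ℝ) ≤ p.natDegree := by exact_mod_cast hp
  have hm0 : (0 : ℝ) < p.natDegree := by linarith
  have hT : 0 ≤ ∑' k : ℤ, 1 / (1 + |(k : ℝ)|) ^ 2 := tsum_nonneg fun k => by positivity
  refine ⟨4 / (1 / (p.natDegree : ℝ)) ^ 2 * (∑' k : ℤ, 1 / (1 + |(k : ℝ)|) ^ 2) +
    hfin.toFinset.card + 1, by positivity, fun t S => ?_⟩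
  rw [← Finset.sum_filter_add_sum_filter_not S (fun v : zeroSet p => (v : ℂ).re ≤ -X₀)]
  have h1 := sum_one_div_one_add_abs_sub_sq_le (S.filter fun v : zeroSet p => (v : ℂ).re ≤ -X₀)
    (fun v : zeroSet p => (v : ℂ).im) (δ := 1 / (p.natDegree : ℝ)) (by positivity)
    ((div_le_one hm0).2 hm) (fun v hv w hw hvw => Subtype.ext (hsep v.1 v.2 w.1 w.2
      (Finset.mem_filter.1 hv).2 (Finset.mem_filter.1 hw).2 hvw)) t
  have h2 : ∑ v ∈ S.filter (fun v : zeroSet p => ¬ (v : ℂ).re ≤ -X₀),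
      1 / (1 + |t - (v : ℂ).im|) ^ 2 ≤
      (hfin.toFinset.card : ℝ) := by
    calc _ ≤ ∑ v ∈ S.filter (fun v : zeroSet p => ¬ (v : ℂ).re ≤ -X₀), (1 : ℝ) := by
          refine Finset.sum_le_sum fun v _ => ?_
          rw [div_le_one (by positivity)]
          have := abs_nonneg (t - (v : ℂ).im)
          nlinarith
      _ = (S.filter (fun v : zeroSet p => ¬ (v : ℂ).re ≤ -X₀)).card := by simp
      _ ≤ _ := by
          norm_cast
          rw [← Finset.card_image_of_injective _ Subtype.val_injective]
          refine Finset.card_le_card fun z hz => ?_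
          obtain ⟨v, hv, rfl⟩ := Finset.mem_image.1 hz
          rw [Set.Finite.mem_toFinset]
          exact ⟨v.2, not_le.1 (Finset.mem_filter.1 hv).2⟩
  linarith

/-- On the left the derivative dominates the scale, and the scale dominates `1 + |v|` at a zero. The
remaining zeros are finite in number and are absorbed in the constant. -/
theorem exists_norm_inv_quasiPolyDeriv_le {p : ℂ[X]} (hp : 1 ≤ p.natDegree) (hs : SimpleZeros p) :
    ∃ C : ℝ, 0 < C ∧ ∀ v ∈ zeroSet p, ‖(quasiPolyDeriv p v)⁻¹‖ ≤ C / (1 + ‖v‖) := by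
  obtain ⟨X₀, c, hX, hc, -, hlow⟩ := exists_zero_separation p hp
  obtain ⟨K, hK0, hK⟩ := exists_norm_sub_quasiPoly_le p
  have hfin := finite_zeroSet_re_gt hs X₀
  obtain ⟨B, hB⟩ := (hfin.image fun v => ‖(quasiPolyDeriv p v)⁻¹‖ * (1 + ‖v‖)).bddAbove
  refine ⟨max B ((1 + K) * (1 / X₀ + 1) / c), lt_max_of_lt_right (by positivity), fun v hv => ?_⟩
  rw [le_div_iff₀ (by positivity)]
  by_cases h : v.re ≤ -X₀
  · refine le_trans ?_ (le_max_right _ _)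
    have h1 := hlow v h
    have h2 := norm_le_of_mem_zeroSet hK hv
    have h3 : X₀ ≤ scale p v := le_scale p hp hX.le h
    have h4 := scale_pos p v
    have h5 : 1 ≤ 1 / X₀ * scale p v := by
      rw [div_mul_eq_mul_div, one_mul, le_div_iff₀ hX]; linarith
    have h6 : 1 + ‖v‖ ≤ (1 + K) * (1 / X₀ + 1) * scale p v := by nlinarith
    rw [norm_inv]
    calc ‖quasiPolyDeriv p v‖⁻¹ * (1 + ‖v‖)
        ≤ (c * scale p v)⁻¹ * ((1 + K) * (1 / X₀ + 1) * scale p v) := by gcongr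
      _ = _ := by field_simp
  · exact (hB ⟨v, ⟨hv, not_le.1 h⟩, rfl⟩).trans (le_max_left _ _)

/-! ### Decay on the good set -/

/-- The points at which `quasiPoly p` is as large as its growth scale suggests. -/
def goodSet (p : ℂ[X]) (c : ℝ) : Set ℂ := {w | c * (1 + scale p w) ≤ ‖quasiPoly p w‖}

/-- By the mean value inequality the function cannot fall from its full size at `w` to `0` within a
short fixed distance. For zeros at a different height, the difference of imaginary parts gives the
linear growth. -/
theorem exists_le_norm_sub_zero {p : ℂ[X]} (hp : 1 ≤ p.natDegree) {c : ℝ} (hc : 0 < c) :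
    ∃ d : ℝ, 0 < d ∧ ∀ w ∈ goodSet p c, ∀ v ∈ zeroSet p,
      d * (1 + |w.im - v.im|) ≤ ‖w - v‖ := by
  obtain ⟨K, hK0, hK⟩ := exists_norm_quasiPolyDeriv_le p hp
  -- The scale changes by a factor of at most `e^m` over a unit distance.
  set L := Real.exp p.natDegree with hL
  have hL1 : 1 ≤ L := Real.one_le_exp (Nat.cast_nonneg _)
  have key : ∀ w ∈ goodSet p c, ∀ v ∈ zeroSet p, min 1 (c / (K * L)) ≤ ‖w - v‖ := by
    intro w hw v hv
    rcases le_total 1 ‖w - v‖ with h1 | h1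
    · exact (min_le_left _ _).trans h1
    refine (min_le_right _ _).trans ?_
    have hder : ∀ z ∈ Metric.closedBall w 1, ‖deriv (quasiPoly p) z‖ ≤ K * L * (1 + scale p w) := by
      intro z hz
      rw [(hasDerivAt_quasiPoly p z).deriv]
      refine (hK z).trans ?_
      rw [mul_assoc]
      gcongr
      have h2 : scale p z ≤ L * scale p w := by
        rw [scale_eq, scale_eq, hL, ← Real.exp_add]
        gcongr
        have h3 := (abs_le.1 ((Complex.abs_re_le_norm (z - w)).trans
          (by simpa [dist_eq_norm] using hz))).1
        rw [Complex.sub_re] at h3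
        have : (0 : ℝ) ≤ p.natDegree := Nat.cast_nonneg _
        nlinarith
      linarith
    have hmv := (convex_closedBall w 1).norm_image_sub_le_of_norm_deriv_le (𝕜 := ℂ)
      (fun z _ => differentiable_quasiPoly p z) hder
      (show v ∈ Metric.closedBall w 1 by
        rwa [Metric.mem_closedBall, dist_eq_norm, norm_sub_rev])
      (Metric.mem_closedBall_self zero_le_one)
    rw [show quasiPoly p v = 0 from hv, sub_zero] at hmv
    have hw' : c * (1 + scale p w) ≤ ‖quasiPoly p w‖ := hw
    have hs := scale_pos p w
    rw [div_le_iff₀ (by positivity)]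
    have : c * (1 + scale p w) ≤ (‖w - v‖ * (K * L)) * (1 + scale p w) := by
      refine (hw'.trans hmv).trans (le_of_eq (by ring))
    exact le_of_mul_le_mul_right this (by linarith)
  have he : 0 < min 1 (c / (K * L)) := lt_min one_pos (by positivity)
  have he1 : min 1 (c / (K * L)) ≤ 1 := min_le_left _ _
  generalize min 1 (c / (K * L)) = e at *
  refine ⟨e / 2, by positivity, fun w hw v hv => ?_⟩
  have h1 := key w hw v hv
  have h2 := Complex.abs_im_le_norm (w - v)
  rw [Complex.sub_im] at h2
  rcases le_total |w.im - v.im| 1 with h3 | h3 <;> nlinarith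

theorem exists_sum_inv_norm_sub_sq_le {p : ℂ[X]} (hp : 1 ≤ p.natDegree) (hs : SimpleZeros p)
    {c : ℝ} (hc : 0 < c) :
    ∃ M : ℝ, 0 < M ∧ ∀ w ∈ goodSet p c, ∀ S : Finset (zeroSet p),
      ∑ v ∈ S, 1 / ‖w - v‖ ^ 2 ≤ M := by
  obtain ⟨d, hd, hdist⟩ := exists_le_norm_sub_zero hp hc
  obtain ⟨M, hM0, hM⟩ := exists_sum_zeroSet_le hp hs
  refine ⟨M / d ^ 2, by positivity, fun w hw S => ?_⟩
  calc ∑ v ∈ S, 1 / ‖w - v‖ ^ 2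
      ≤ ∑ v ∈ S, 1 / d ^ 2 * (1 / (1 + |w.im - (v : ℂ).im|) ^ 2) := by
        refine Finset.sum_le_sum fun v _ => ?_
        rw [one_div_mul_one_div, ← mul_pow]
        gcongr
        exact hdist w hw v v.2
    _ ≤ M / d ^ 2 := by
        rw [← Finset.mul_sum, one_div, mul_comm, div_eq_mul_inv]
        gcongr
        exact hM _ S

theorem summable_inv_one_add_norm_sq {p : ℂ[X]} (hp : 1 ≤ p.natDegree) (hs : SimpleZeros p) :
    Summable fun v : zeroSet p => 1 / (1 + ‖(v : ℂ)‖) ^ 2 := by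
  obtain ⟨M, hM0, hM⟩ := exists_sum_zeroSet_le hp hs
  refine summable_of_sum_le (c := M) (fun v => by positivity) fun S => ?_
  refine (Finset.sum_le_sum fun v _ => ?_).trans (hM 0 S)
  rw [zero_sub, abs_neg]
  gcongr
  exact Complex.abs_im_le_norm _

theorem summable_norm_inv_deriv_sq {p : ℂ[X]} (hp : 1 ≤ p.natDegree) (hs : SimpleZeros p) :
    Summable fun v : zeroSet p => ‖(quasiPolyDeriv p v)⁻¹‖ ^ 2 := by
  obtain ⟨C, hC0, hC⟩ := exists_norm_inv_quasiPolyDeriv_le hp hs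
  refine Summable.of_nonneg_of_le (fun v => by positivity) (fun v => ?_)
    ((summable_inv_one_add_norm_sq hp hs).mul_left (C ^ 2))
  rw [mul_one_div, ← div_pow]
  gcongr
  exact hC v v.2

theorem summable_norm_inv_deriv_div {p : ℂ[X]} (hp : 1 ≤ p.natDegree) (hs : SimpleZeros p) :
    Summable fun v : zeroSet p => ‖(quasiPolyDeriv p v)⁻¹‖ * (1 / (1 + ‖(v : ℂ)‖)) := by
  obtain ⟨C, hC0, hC⟩ := exists_norm_inv_quasiPolyDeriv_le hp hs
  refine Summable.of_nonneg_of_le (fun v => by positivity) (fun v => ?_)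
    ((summable_inv_one_add_norm_sq hp hs).mul_left C)
  have h := hC v v.2
  calc ‖(quasiPolyDeriv p v)⁻¹‖ * (1 / (1 + ‖(v : ℂ)‖))
      ≤ C / (1 + ‖(v : ℂ)‖) * (1 / (1 + ‖(v : ℂ)‖)) := by gcongr
    _ = _ := by rw [div_mul_div_comm, mul_one_div, ← sq, mul_one]

/-- A weighted Cauchy–Schwarz argument: the residues are square summable, and `∑ 1/|w - v|²` is
bounded uniformly on the good set. Finitely many terms tend to `0` individually, and the tail is
small uniformly. -/
theorem tendsto_tsum_norm_inv_deriv_div {p : ℂ[X]} (hp : 1 ≤ p.natDegree) (hs : SimpleZeros p)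
    {c : ℝ} (hc : 0 < c) :
    Tendsto (fun w : ℂ => ∑' v : zeroSet p, ‖(quasiPolyDeriv p v)⁻¹‖ / ‖w - v‖)
      (Bornology.cobounded ℂ ⊓ 𝓟 (goodSet p c)) (𝓝 0) := by
  classical
  obtain ⟨M, hM0, hM⟩ := exists_sum_inv_norm_sub_sq_le hp hs hc
  have hsq := summable_norm_inv_deriv_sq hp hs
  rw [Metric.tendsto_nhds]
  intro ε hε
  -- `l` is the weight in `xy ≤ x²/(2l) + l y²/2`. It makes the second part of the tail at most
  -- `ε/4`; the tail of squares below `lε/2` makes the first part less than `ε/4`.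
  obtain ⟨l, hl⟩ : ∃ l : ℝ, l = ε / (2 * M) := ⟨_, rfl⟩
  have hl0 : 0 < l := by rw [hl]; positivity
  have htail := (tendsto_order.1 (tendsto_tsum_compl_atTop_zero
    fun v : zeroSet p => ‖(quasiPolyDeriv p v)⁻¹‖ ^ 2)).2 (l * ε / 2) (by positivity)
  obtain ⟨S, hS⟩ := htail.exists
  have hfin : Tendsto (fun w : ℂ => ∑ v ∈ S, ‖(quasiPolyDeriv p v)⁻¹‖ / ‖w - v‖)
      (Bornology.cobounded ℂ) (𝓝 0) := by
    rw [show (0 : ℝ) = ∑ v ∈ S, (0 : ℝ) by simp]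
    refine tendsto_finsetSum _ fun v _ => ?_
    refine Tendsto.div_atTop tendsto_const_nhds ?_
    exact tendsto_norm_cobounded_atTop.comp (tendsto_sub_const_cobounded (v : ℂ))
  have hfin' := (tendsto_order.1 hfin).2 (ε / 2) (by positivity)
  filter_upwards [hfin'.filter_mono inf_le_left, mem_inf_of_right (mem_principal_self _)]
    with w hw1 hw2
  have hM' := hM w hw2
  have hsum2 : Summable fun v : zeroSet p => 1 / ‖w - v‖ ^ 2 :=
    summable_of_sum_le (fun v => by positivity) hM'
  have hpt : ∀ v : zeroSet p, ‖(quasiPolyDeriv p v)⁻¹‖ / ‖w - v‖ ≤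
      1 / (2 * l) * ‖(quasiPolyDeriv p v)⁻¹‖ ^ 2 + l / 2 * (1 / ‖w - v‖ ^ 2) := by
    intro v
    have h1 := sq_nonneg (‖(quasiPolyDeriv p v)⁻¹‖ - l * (1 / ‖w - v‖))
    have h2 : 1 / (2 * l) * ‖(quasiPolyDeriv p v)⁻¹‖ ^ 2 + l / 2 * (1 / ‖w - v‖ ^ 2) -
        ‖(quasiPolyDeriv p v)⁻¹‖ / ‖w - v‖ =
        1 / (2 * l) * (‖(quasiPolyDeriv p v)⁻¹‖ - l * (1 / ‖w - v‖)) ^ 2 := by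
      rw [← one_div_pow, div_eq_mul_one_div ‖(quasiPolyDeriv p v)⁻¹‖ ‖w - v‖]
      generalize 1 / ‖w - v‖ = r
      field_simp
      ring
    have h3 : 0 ≤ 1 / (2 * l) * (‖(quasiPolyDeriv p v)⁻¹‖ - l * (1 / ‖w - v‖)) ^ 2 := by
      positivity
    linarith
  have hsumB := (hsq.mul_left (1 / (2 * l))).add (hsum2.mul_left (l / 2))
  have hsum : Summable fun v : zeroSet p => ‖(quasiPolyDeriv p v)⁻¹‖ / ‖w - v‖ :=
    Summable.of_nonneg_of_le (fun v => by positivity) hpt hsumB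
  have hnn : 0 ≤ ∑' v : zeroSet p, ‖(quasiPolyDeriv p v)⁻¹‖ / ‖w - v‖ :=
    tsum_nonneg fun v => by positivity
  rw [dist_zero_right, Real.norm_of_nonneg hnn, ← hsum.sum_add_tsum_subtype_compl S]
  have hsubsq : Summable fun v : {v : zeroSet p // v ∉ S} =>
      ‖(quasiPolyDeriv p v)⁻¹‖ ^ 2 := hsq.comp_injective
    (Subtype.val_injective (p := fun v : zeroSet p => v ∉ S))
  have hsub2 : Summable fun v : {v : zeroSet p // v ∉ S} =>
      1 / ‖w - v‖ ^ 2 := hsum2.comp_injective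
    (Subtype.val_injective (p := fun v : zeroSet p => v ∉ S))
  have hsub : Summable fun v : {v : zeroSet p // v ∉ S} =>
      ‖(quasiPolyDeriv p v)⁻¹‖ / ‖w - v‖ := hsum.comp_injective
    (Subtype.val_injective (p := fun v : zeroSet p => v ∉ S))
  have h4 : ∑' v : {v : zeroSet p // v ∉ S}, ‖(quasiPolyDeriv p v)⁻¹‖ / ‖w - v‖ ≤
      1 / (2 * l) * (∑' v : {v : zeroSet p // v ∉ S}, ‖(quasiPolyDeriv p v)⁻¹‖ ^ 2) +
      l / 2 * M := by
    refine (Summable.tsum_le_tsum (fun v : {v : zeroSet p // v ∉ S} => hpt v) hsub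
      ((hsubsq.mul_left (1 / (2 * l))).add (hsub2.mul_left (l / 2)))).trans ?_
    rw [(hsubsq.mul_left (1 / (2 * l))).tsum_add (hsub2.mul_left (l / 2)), tsum_mul_left,
      tsum_mul_left]
    gcongr
    refine (Summable.tsum_subtype_le (fun v : zeroSet p => 1 / ‖w - v‖ ^ 2) {v | v ∉ S}
      (fun v => by positivity) hsum2).trans ?_
    exact Real.tsum_le_of_sum_le (fun v => by positivity) hM'
  have h5 : 1 / (2 * l) * (∑' v : {v : zeroSet p // v ∉ S}, ‖(quasiPolyDeriv p v)⁻¹‖ ^ 2) <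
      1 / (2 * l) * (l * ε / 2) := by
    gcongr
  have h6 : 1 / (2 * l) * (l * ε / 2) = ε / 4 := by field_simp; norm_num
  have h7 : l / 2 * M = ε / 4 := by rw [hl]; field_simp; norm_num
  linarith

theorem tendsto_inv_quasiPoly (p : ℂ[X]) {c : ℝ} (hc : 0 < c) :
    Tendsto (fun w : ℂ => (quasiPoly p w)⁻¹) (Bornology.cobounded ℂ ⊓ 𝓟 (goodSet p c)) (𝓝 0) := by
  obtain ⟨K, hK0, hK⟩ := exists_norm_sub_quasiPoly_le p
  refine tendsto_inv₀_cobounded.comp ?_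
  rw [← tendsto_norm_atTop_iff_cobounded]
  have h1 : Tendsto (fun w : ℂ => (K / c + 1)⁻¹ * ‖w‖)
      (Bornology.cobounded ℂ ⊓ 𝓟 (goodSet p c)) atTop :=
    (tendsto_norm_cobounded_atTop.const_mul_atTop (by positivity)).mono_left inf_le_left
  refine tendsto_atTop_mono' _ ?_ h1
  filter_upwards [mem_inf_of_right (mem_principal_self _)] with w hw
  rw [inv_mul_le_iff₀ (by positivity)]
  have h2 := norm_le_norm_sub_add w (quasiPoly p w)
  have h3 : 1 + scale p w ≤ ‖quasiPoly p w‖ / c := by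
    rw [le_div_iff₀ hc, mul_comm]; exact hw
  have h4 := mul_le_mul_of_nonneg_left h3 hK0.le
  have h5 := hK w
  have h6 : K * (‖quasiPoly p w‖ / c) = K / c * ‖quasiPoly p w‖ := by ring
  linarith

/-! ### Large rectangles with boundary in the good set -/

theorem exists_large_mul_add_eq {m : ℝ} (hm : 0 < m) (φ B : ℝ) :
    ∃ T : ℝ, B ≤ T ∧ ∃ k : ℕ, m * T = φ + k * (2 * Real.pi) := by
  obtain ⟨k, hk⟩ := exists_nat_ge ((m * B - φ) / (2 * Real.pi))
  refine ⟨(φ + k * (2 * Real.pi)) / m, ?_, k, by field_simp⟩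
  rw [div_le_iff₀ (by positivity)] at hk
  rw [le_div_iff₀ hm]
  linarith

theorem eq_norm_mul_exp_arg (b : ℂ) : b = ‖b‖ * Complex.exp (b.arg * Complex.I) :=
  (Complex.norm_mul_exp_arg_mul_I b).symm

/-- At such a height `T > 0`, minus the leading exponential term is a positive multiple of `i`, so
its imaginary part adds to `Im w = T` without cancellation. -/
theorem exists_ge_leading_direction {m : ℝ} (hm : 0 < m) (b : ℂ) (B : ℝ) :
    ∃ T : ℝ, B ≤ T ∧ b * Complex.exp (-(m * T * Complex.I)) = -(‖b‖ * Complex.I) := by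
  obtain ⟨T, hT, k, hk⟩ := exists_large_mul_add_eq hm (b.arg + Real.pi / 2) B
  refine ⟨T, hT, ?_⟩
  nth_rw 1 [eq_norm_mul_exp_arg b]
  rw [mul_assoc, ← Complex.exp_add, ← Complex.ofReal_mul, hk]
  have : (b.arg : ℂ) * Complex.I + -(((b.arg + Real.pi / 2 + k * (2 * Real.pi) : ℝ) : ℂ) *
      Complex.I) = -(Real.pi / 2 * Complex.I) - k * (2 * Real.pi * Complex.I) := by
    push_cast; ring
  rw [this, Complex.exp_sub, Complex.exp_nat_mul_two_pi_mul_I, div_one, Complex.exp_neg,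
    Complex.exp_pi_div_two_mul_I, Complex.inv_I]
  ring

theorem exists_le_leading_direction {m : ℝ} (hm : 0 < m) (b : ℂ) (B : ℝ) :
    ∃ T : ℝ, B ≤ T ∧ b * Complex.exp (-(m * (-T : ℝ) * Complex.I)) = ‖b‖ * Complex.I := by
  obtain ⟨T, hT, h⟩ := exists_ge_leading_direction hm (star b) B
  refine ⟨T, hT, ?_⟩
  have := congrArg star h
  simpa [← Complex.exp_conj] using this

/-- On the horizontal sides the heights are tuned so that `w` and the leading term cannot cancel. On
the left side the exponential dominates, on the right side `w` does. -/
theorem exists_good_rectangle (p : ℂ[X]) (hp : 1 ≤ p.natDegree) :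
    ∃ c : ℝ, 0 < c ∧ ∀ R : ℝ, ∃ U : Set ℂ, IsOpen U ∧ Bornology.IsBounded U ∧
      Metric.ball 0 R ⊆ U ∧ frontier U ⊆ goodSet p c := by
  have hb := norm_leadingCoeff_pos p hp
  have hm : (0 : ℝ) < p.natDegree := by exact_mod_cast hp
  set b := p.leadingCoeff with hbd
  obtain ⟨K, hK0, hK⟩ := exists_norm_eval_sub_leading_le p le_rfl (ε := ‖b‖ / 4) (by positivity)
  have hK' : ∀ w, ‖p.eval (Complex.exp (-w)) - b * Complex.exp (-w) ^ p.natDegree‖ ≤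
      ‖b‖ / 4 * scale p w + K := fun w => hK _
  have hsc : ∀ w : ℂ, ‖b * Complex.exp (-w) ^ p.natDegree‖ = ‖b‖ * scale p w := by
    intro w; rw [norm_mul, norm_pow]; rfl
  refine ⟨‖b‖ / 2, by positivity, fun R => ?_⟩
  obtain ⟨T, hT, hTd⟩ := exists_ge_leading_direction hm b (max (max R 1) (K + ‖b‖))
  obtain ⟨T', hT', hTd'⟩ := exists_le_leading_direction hm b (max (max R 1) (K + ‖b‖))
  simp only [max_le_iff] at hT hT'
  -- The term `2 * X` bounds `|w|` on the left side, since `X` is also taken to be at least `T +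
  -- T'`.
  have hX : ∀ᶠ X : ℝ in atTop, ‖b‖ / 4 * Real.exp X ≥ K + 2 * X + ‖b‖ := by
    have h1 : Tendsto (fun X : ℝ => X ^ 1 / Real.exp X) atTop (𝓝 0) :=
      (Real.tendsto_exp_div_pow_atTop 1).inv_tendsto_atTop.congr fun X => inv_div _ _
    have h2 : Tendsto (fun X : ℝ => (K + ‖b‖) / Real.exp X) atTop (𝓝 0) :=
      tendsto_const_nhds.div_atTop Real.tendsto_exp_atTop
    have h3 := h2.add (h1.const_mul 2)
    rw [mul_zero, add_zero] at h3
    filter_upwards [(tendsto_order.1 h3).2 (‖b‖ / 4) (by positivity)] with X hX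
    have hX' : (K + ‖b‖ + 2 * X) / Real.exp X < ‖b‖ / 4 := by
      rw [add_div]; simpa [mul_div_assoc] using hX
    rw [div_lt_iff₀ (Real.exp_pos X)] at hX'
    linarith
  obtain ⟨X, hX1, hX2⟩ := (hX.and (eventually_ge_atTop (T + T' + K + 4 * ‖b‖))).exists
  have hT1 : 1 ≤ T := hT.1.2
  have hT1' : 1 ≤ T' := hT'.1.2
  have hXR : R ≤ X := by linarith [hT.1.1]
  refine ⟨Set.Ioo (-X) X ×ℂ Set.Ioo (-T') T, isOpen_Ioo.reProdIm isOpen_Ioo,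
    (Metric.isBounded_Ioo _ _).reProdIm (Metric.isBounded_Ioo _ _), ?_, ?_⟩
  · intro z hz
    rw [mem_ball_zero_iff] at hz
    have h1 := abs_lt.1 ((Complex.abs_re_le_norm z).trans_lt hz)
    have h2 := abs_lt.1 ((Complex.abs_im_le_norm z).trans_lt hz)
    rw [Complex.mem_reProdIm]
    refine ⟨⟨?_, ?_⟩, ?_, ?_⟩ <;> linarith [hT.1.1, hT'.1.1]
  · rw [Complex.frontier_reProdIm, frontier_Ioo (by linarith), frontier_Ioo (by linarith),
      closure_Ioo (by linarith), closure_Ioo (by linarith)]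
    intro w hw
    have herr := hK' w
    set e := p.eval (Complex.exp (-w)) - b * Complex.exp (-w) ^ p.natDegree with he
    have hG : quasiPoly p w = w - b * Complex.exp (-w) ^ p.natDegree - e := by
      rw [he, quasiPoly]; ring
    have ht := scale_pos p w
    have heim := abs_le.1 ((Complex.abs_im_le_norm e).trans herr)
    have hbt : 0 < ‖b‖ * scale p w := by positivity
    change ‖b‖ / 2 * (1 + scale p w) ≤ ‖quasiPoly p w‖
    rcases hw with hw | hw
    · rw [Complex.mem_reProdIm] at hw
      refine le_trans ?_ (Complex.abs_im_le_norm _)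
      rcases hw.2 with h | h
      · have h1 : b * Complex.exp (-w) ^ p.natDegree = scale p w * (‖b‖ * Complex.I) := by
          rw [← hTd', exp_pow_eq, h]
          push_cast; ring
        rw [hG, h1]
        refine le_trans ?_ (neg_le_abs _)
        simp [h]
        linarith [hT'.2, heim.1]
      · have h1 : b * Complex.exp (-w) ^ p.natDegree = scale p w * -(‖b‖ * Complex.I) := by
          rw [← hTd, exp_pow_eq, show w.im = T from h]
          push_cast; ring
        rw [hG, h1]
        refine le_trans ?_ (le_abs_self _)
        simp [show w.im = T from h]
        linarith [hT.2, heim.2]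
    · rw [Complex.mem_reProdIm] at hw
      have h0 := hsc w
      set q := b * Complex.exp (-w) ^ p.natDegree with hq
      rcases hw.1 with h | h
      · have h1 : ‖q‖ ≤ ‖quasiPoly p w‖ + ‖w‖ + ‖e‖ := by
          have : q = -quasiPoly p w + w - e := by rw [hG]; ring
          rw [this]
          refine (norm_sub_le _ _).trans ?_
          gcongr
          refine (norm_add_le _ _).trans ?_
          rw [norm_neg]
        have h2 : ‖w‖ ≤ X + (T + T') := by
          refine (Complex.norm_le_abs_re_add_abs_im w).trans ?_
          have : |w.im| ≤ T + T' := abs_le.2 ⟨by linarith [hw.2.1], by linarith [hw.2.2]⟩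
          have : |w.re| ≤ X := by rw [h, abs_neg, abs_of_nonneg (by linarith)]
          linarith
        have h3 : Real.exp X ≤ scale p w := by
          rw [scale_eq, h]
          have : (1 : ℝ) ≤ p.natDegree := by exact_mod_cast hp
          gcongr
          nlinarith
        have h4 : ‖b‖ / 4 * Real.exp X ≤ ‖b‖ / 4 * scale p w := by gcongr
        linarith
      · have h' : w.re = X := h
        have h1 : ‖w‖ ≤ ‖quasiPoly p w‖ + ‖q‖ + ‖e‖ := by
          have : w = quasiPoly p w + q + e := by rw [hG]; ring
          nth_rw 1 [this]
          refine (norm_add_le _ _).trans ?_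
          gcongr
          exact norm_add_le _ _
        have h2 : X ≤ ‖w‖ := h' ▸ Complex.re_le_norm w
        have h3 : scale p w ≤ 1 := by
          rw [scale_eq, h', Real.exp_le_one_iff]
          have : 0 ≤ p.natDegree * X := mul_nonneg hm.le (by linarith)
          linarith
        have h4 : ‖b‖ * scale p w ≤ ‖b‖ * 1 := by gcongr
        linarith

/-! ### The remainder of the expansion vanishes -/

/-- The entire function `1 - G(w) ∑ 1 / (G'(v) (w - v))`, the sum running over the zeros `v` of
`G = quasiPoly p`. -/
def remainderNum (p : ℂ[X]) (w : ℂ) : ℂ :=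
  1 - ∑' v : zeroSet p, (quasiPolyDeriv p v)⁻¹ * dslope (quasiPoly p) v w

open Classical in
/-- The entire function `1 / G(w) - ∑ 1 / (G'(v) (w - v))`, the sum running over the zeros `v` of
`G = quasiPoly p`. -/
def remainder (p : ℂ[X]) (w : ℂ) : ℂ :=
  if quasiPoly p w = 0 then deriv (remainderNum p) w / quasiPolyDeriv p w
  else remainderNum p w / quasiPoly p w

theorem deriv_quasiPoly (p : ℂ[X]) : deriv (quasiPoly p) = quasiPolyDeriv p :=
  funext fun w => (hasDerivAt_quasiPoly p w).deriv

theorem dslope_quasiPoly_of_ne {p : ℂ[X]} {v w : ℂ} (hv : v ∈ zeroSet p) (h : w ≠ v) :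
    dslope (quasiPoly p) v w = quasiPoly p w / (w - v) := by
  rw [dslope_of_ne _ h, slope_def_field, show quasiPoly p v = 0 from hv, sub_zero]

/-- For zeros near the disc the mean value inequality suffices; for distant ones the quotient
`G(w)/(w - v)` supplies the decay `1/(1+|v|)`, which makes the series converge locally uniformly. -/
theorem exists_norm_dslope_le (p : ℂ[X]) {R : ℝ} (hR : 0 ≤ R) :
    ∃ K : ℝ, ∀ v ∈ zeroSet p, ∀ w ∈ Metric.ball (0 : ℂ) R,
      ‖dslope (quasiPoly p) v w‖ ≤ K * (1 / (1 + ‖v‖)) := by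
  have hcd : Continuous (deriv (quasiPoly p)) :=
    (differentiable_quasiPoly p).contDiff.continuous_deriv le_top
  obtain ⟨M₁, hM₁⟩ := (isCompact_closedBall (0 : ℂ) (R + 1)).exists_bound_of_continuousOn
    hcd.continuousOn
  obtain ⟨M₀, hM₀⟩ := (isCompact_closedBall (0 : ℂ) R).exists_bound_of_continuousOn
    (differentiable_quasiPoly p).continuous.continuousOn
  have hM₀0 : 0 ≤ M₀ := (norm_nonneg _).trans (hM₀ 0 (by simpa using hR))
  have hM₁0 : 0 ≤ M₁ := (norm_nonneg _).trans (hM₁ 0 (by simpa using by linarith))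
  refine ⟨(M₀ + M₁) * (R + 2), fun v hv w hw => ?_⟩
  rw [mem_ball_zero_iff] at hw
  have hv0 := norm_nonneg v
  rw [mul_one_div, le_div_iff₀ (by positivity)]
  rcases le_total ‖v‖ (R + 1) with h | h
  · have h1 : ‖dslope (quasiPoly p) v w‖ ≤ M₁ := by
      rcases eq_or_ne w v with rfl | hne
      · rw [dslope_same]
        exact hM₁ w (by simpa using h)
      · rw [dslope_quasiPoly_of_ne hv hne, norm_div,
          div_le_iff₀ (norm_pos_iff.2 (sub_ne_zero.2 hne))]
        have := (convex_closedBall (0 : ℂ) (R + 1)).norm_image_sub_le_of_norm_deriv_le (𝕜 := ℂ)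
          (fun z _ => differentiable_quasiPoly p z) hM₁
          (show v ∈ _ by simpa using h) (show w ∈ _ by simpa using by linarith)
        rwa [show quasiPoly p v = 0 from hv, sub_zero] at this
    calc ‖dslope (quasiPoly p) v w‖ * (1 + ‖v‖) ≤ M₁ * (R + 2) :=
          mul_le_mul h1 (by linarith) (by positivity) hM₁0
      _ ≤ _ := by gcongr; linarith
  · have hne : w ≠ v := by
      rintro rfl; linarith
    have h1 : ‖v‖ - R ≤ ‖w - v‖ := by
      have := norm_sub_norm_le v w
      rw [norm_sub_rev] at this
      linarith
    -- The difference of the two sides is at least `(R + 1)(‖v‖ - (R + 1)) ≥ 0`.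
    have h2 : 1 + ‖v‖ ≤ (R + 2) * ‖w - v‖ := by nlinarith
    rw [dslope_quasiPoly_of_ne hv hne, norm_div, div_mul_eq_mul_div,
      div_le_iff₀ (norm_pos_iff.2 (sub_ne_zero.2 hne))]
    calc ‖quasiPoly p w‖ * (1 + ‖v‖) ≤ M₀ * ((R + 2) * ‖w - v‖) := by
          gcongr
          exact hM₀ w (by simpa using hw.le)
      _ = M₀ * (R + 2) * ‖w - v‖ := by ring
      _ ≤ _ := by gcongr; linarith

theorem differentiable_dslope_quasiPoly (p : ℂ[X]) (v : ℂ) :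
    Differentiable ℂ (dslope (quasiPoly p) v) := by
  rw [← differentiableOn_univ, Complex.differentiableOn_dslope univ_mem]
  exact (differentiable_quasiPoly p).differentiableOn

theorem norm_remainder_term_le {p : ℂ[X]} {K R : ℝ}
    (hK : ∀ v ∈ zeroSet p, ∀ w ∈ Metric.ball (0 : ℂ) R,
      ‖dslope (quasiPoly p) v w‖ ≤ K * (1 / (1 + ‖v‖))) (v : zeroSet p) {w : ℂ}
    (hw : w ∈ Metric.ball (0 : ℂ) R) :
    ‖(quasiPolyDeriv p v)⁻¹ * dslope (quasiPoly p) v w‖ ≤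
      K * (‖(quasiPolyDeriv p v)⁻¹‖ * (1 / (1 + ‖(v : ℂ)‖))) := by
  rw [norm_mul]
  calc ‖(quasiPolyDeriv p v)⁻¹‖ * ‖dslope (quasiPoly p) v w‖
      ≤ ‖(quasiPolyDeriv p v)⁻¹‖ * (K * (1 / (1 + ‖(v : ℂ)‖))) := by
        gcongr
        exact hK v v.2 w hw
    _ = _ := by ring

theorem differentiable_remainderNum {p : ℂ[X]} (hp : 1 ≤ p.natDegree) (hs : SimpleZeros p) :
    Differentiable ℂ (remainderNum p) := by
  intro w
  obtain ⟨K, hK⟩ := exists_norm_dslope_le p (R := ‖w‖ + 1) (by positivity)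
  have h := Complex.differentiableOn_tsum_of_summable_norm
    ((summable_norm_inv_deriv_div hp hs).mul_left K)
    (fun v => ((differentiable_dslope_quasiPoly p v).const_mul
      (quasiPolyDeriv p v)⁻¹).differentiableOn) Metric.isOpen_ball
    (fun v z hz => norm_remainder_term_le hK v hz)
  exact (h.differentiableAt (Metric.isOpen_ball.mem_nhds (by simp))).const_sub 1

theorem summable_remainder_terms {p : ℂ[X]} (hp : 1 ≤ p.natDegree) (hs : SimpleZeros p) (w : ℂ) :
    Summable fun v : zeroSet p => (quasiPolyDeriv p v)⁻¹ * dslope (quasiPoly p) v w := by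
  obtain ⟨K, hK⟩ := exists_norm_dslope_le p (R := ‖w‖ + 1) (by positivity)
  exact Summable.of_norm_bounded ((summable_norm_inv_deriv_div hp hs).mul_left K)
    fun v => norm_remainder_term_le hK v (by simp)

/-- Every divided difference at another zero vanishes; the one at `v` itself is the derivative, and
its term equals `1`. -/
theorem remainderNum_eq_zero {p : ℂ[X]} (hs : SimpleZeros p) {v : ℂ} (hv : v ∈ zeroSet p) :
    remainderNum p v = 0 := by
  rw [remainderNum, tsum_eq_single (⟨v, hv⟩ : zeroSet p)]
  · simp [dslope_same, deriv_quasiPoly, hs v hv]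
  · intro v' hne
    have : v ≠ v' := fun h => hne (Subtype.ext h.symm)
    rw [dslope_quasiPoly_of_ne v'.2 this, show quasiPoly p v = 0 from hv, zero_div, mul_zero]

/-- At a simple zero, numerator and denominator both contain the factor `z - w`. Cancelling it
leaves a quotient of divided differences with nonvanishing denominator, whose value at `w` is the
ratio of derivatives. -/
theorem differentiable_remainder {p : ℂ[X]} (hp : 1 ≤ p.natDegree) (hs : SimpleZeros p) :
    Differentiable ℂ (remainder p) := by
  intro w
  have hF := differentiable_remainderNum hp hs
  have hG := differentiable_quasiPoly p
  by_cases hw : quasiPoly p w = 0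
  · have hD : dslope (quasiPoly p) w w ≠ 0 := by
      rw [dslope_same, deriv_quasiPoly]; exact hs w hw
    have hdF : DifferentiableAt ℂ (dslope (remainderNum p) w) w :=
      (((Complex.differentiableOn_dslope univ_mem).2 hF.differentiableOn) w
        (Set.mem_univ w)).differentiableAt univ_mem
    refine (hdF.div (differentiable_dslope_quasiPoly p w w) hD).congr_of_eventuallyEq ?_
    have hev := (hasDerivAt_quasiPoly p w).eventually_ne (c := 0) (hs w hw)
    rw [eventually_nhdsWithin_iff] at hev
    filter_upwards [hev] with z hz
    rcases eq_or_ne z w with rfl | hne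
    · simp [remainder, hw, dslope_same, deriv_quasiPoly]
    · have hz0 := hz hne
      have hd : z - w ≠ 0 := sub_ne_zero.2 hne
      rw [remainder, if_neg hz0, Pi.div_apply, dslope_quasiPoly_of_ne hw hne, dslope_of_ne _ hne,
        slope_def_field, remainderNum_eq_zero hs hw, sub_zero]
      field_simp
  · refine ((hF w).div (hG w) hw).congr_of_eventuallyEq ?_
    filter_upwards [hG.continuous.continuousAt.eventually_ne hw] with z hz
    rw [remainder, if_neg hz, Pi.div_apply]

theorem remainder_eq {p : ℂ[X]} {w : ℂ} (hw : quasiPoly p w ≠ 0) :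
    remainder p w = (quasiPoly p w)⁻¹ - ∑' v : zeroSet p, (quasiPolyDeriv p v)⁻¹ / (w - v) := by
  rw [remainder, if_neg hw, remainderNum]
  have : ∀ v : zeroSet p, (quasiPolyDeriv p v)⁻¹ * dslope (quasiPoly p) v w =
      quasiPoly p w * ((quasiPolyDeriv p v)⁻¹ / (w - v)) := by
    intro v
    have hne : w ≠ v := fun h => hw (h ▸ v.2)
    rw [dslope_quasiPoly_of_ne v.2 hne]
    ring
  simp_rw [this, tsum_mul_left]
  field_simp

theorem summable_partial_fractions {p : ℂ[X]} (hp : 1 ≤ p.natDegree) (hs : SimpleZeros p) {w : ℂ}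
    (hw : quasiPoly p w ≠ 0) :
    Summable fun v : zeroSet p => (quasiPolyDeriv p v)⁻¹ / (w - v) := by
  refine ((summable_remainder_terms hp hs w).mul_left (quasiPoly p w)⁻¹).congr fun v => ?_
  have hne : w ≠ v := fun h => hw (h ▸ v.2)
  rw [dslope_quasiPoly_of_ne v.2 hne]
  field_simp

theorem remainder_eq_zero {p : ℂ[X]} (hp : 1 ≤ p.natDegree) (hs : SimpleZeros p) (w : ℂ) :
    remainder p w = 0 := by
  obtain ⟨c, hc, hU⟩ := exists_good_rectangle p hp
  have hlim := (tendsto_inv_quasiPoly p hc).norm.add (tendsto_tsum_norm_inv_deriv_div hp hs hc)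
  rw [norm_zero, add_zero] at hlim
  rw [← norm_le_zero_iff]
  refine le_of_forall_pos_le_add fun ε hε => ?_
  rw [zero_add]
  have hev := (tendsto_order.1 hlim).2 ε hε
  rw [eventually_inf_principal] at hev
  obtain ⟨R, -, hR⟩ := hasBasis_cobounded_norm.eventually_iff.1 hev
  obtain ⟨U, hUo, hUb, hball, hfr⟩ := hU (max R (‖w‖ + 1))
  refine Complex.norm_le_of_forall_mem_frontier_norm_le hUb
    (differentiable_remainder hp hs).diffContOnCl (fun z hz => ?_)
    (subset_closure (hball (by simp)))
  -- `U` is open and contains the ball, so its frontier lies far out, where both parts of the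
  -- remainder are already small.
  have hzR : R ≤ ‖z‖ := by
    by_contra h
    rw [hUo.frontier_eq] at hz
    exact hz.2 (hball (by simpa using Or.inl (not_le.1 h)))
  have hzg := hfr hz
  have hz0 : quasiPoly p z ≠ 0 := by
    rw [← norm_pos_iff]
    have := scale_pos p z
    exact lt_of_lt_of_le (by positivity) (show c * (1 + scale p z) ≤ _ from hzg)
  rw [remainder_eq hz0]
  refine (norm_sub_le _ _).trans (le_trans ?_ (hR hzR hzg).le)
  gcongr
  refine (norm_tsum_le_tsum_norm (summable_partial_fractions hp hs hz0).norm).trans_eq ?_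
  simp_rw [norm_div]

/-- The partial fraction expansion of `1 / G` for `G = quasiPoly p` with simple zeros. -/
theorem hasSum_partial_fractions {p : ℂ[X]} (hp : 1 ≤ p.natDegree) (hs : SimpleZeros p) {w : ℂ}
    (hw : quasiPoly p w ≠ 0) :
    HasSum (fun v : zeroSet p => (quasiPolyDeriv p v)⁻¹ / (w - v)) (quasiPoly p w)⁻¹ := by
  have h := remainder_eq hw
  rw [remainder_eq_zero hp hs] at h
  rw [sub_eq_zero.1 h.symm]
  exact (summable_partial_fractions hp hs hw).hasSum

/-! ### There are countably infinitely many zeros -/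

theorem countable_zeroSet {p : ℂ[X]} (hs : SimpleZeros p) : (zeroSet p).Countable := by
  have : zeroSet p = ⋃ n : ℕ, zeroSet p ∩ Metric.closedBall 0 n := by
    rw [← Set.inter_iUnion, Metric.iUnion_closedBall_nat, Set.inter_univ]
  rw [this]
  exact Set.countable_iUnion fun n => (finite_zeroSet_inter_closedBall hs n).countable

/-- For finitely many zeros, multiply the expansion by `w` and write `w/(w - v) = 1 + v/(w - v)`:
the limit is the sum of the residues, whatever the way to infinity. -/
theorem tendsto_mul_inv_quasiPoly_unique {p : ℂ[X]} (hp : 1 ≤ p.natDegree) (hs : SimpleZeros p)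
    [Fintype (zeroSet p)] {l : Filter ℂ} [l.NeBot] (hl : l ≤ Bornology.cobounded ℂ)
    (h0 : ∀ᶠ w in l, quasiPoly p w ≠ 0) {a : ℂ}
    (ha : Tendsto (fun w => w * (quasiPoly p w)⁻¹) l (𝓝 a)) :
    a = ∑ v : zeroSet p, (quasiPolyDeriv p v)⁻¹ := by
  refine tendsto_nhds_unique ha ?_
  have h1 : Tendsto (fun w : ℂ => ∑ v : zeroSet p, (quasiPolyDeriv p v)⁻¹ * (1 + v * (w - v)⁻¹)) l
      (𝓝 (∑ v : zeroSet p, (quasiPolyDeriv p v)⁻¹ * (1 + v * 0))) := by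
    refine tendsto_finsetSum _ fun v _ => ((Tendsto.const_mul _ ?_).const_add _).const_mul _
    exact tendsto_inv₀_cobounded.comp ((tendsto_sub_const_cobounded (v : ℂ)).mono_left hl)
  simp only [mul_zero, add_zero, mul_one] at h1
  refine h1.congr' ?_
  filter_upwards [h0] with w hw
  rw [← (hasSum_partial_fractions hp hs hw).tsum_eq, tsum_fintype, Finset.mul_sum]
  refine Finset.sum_congr rfl fun v _ => ?_
  have hne : w - v ≠ 0 := fun h => hw (sub_eq_zero.1 h ▸ v.2)
  field_simp
  ring

theorem exists_norm_quasiPoly_ge (p : ℂ[X]) (hp : 1 ≤ p.natDegree) :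
    ∀ᶠ x : ℝ in atTop, x ^ 2 ≤ ‖quasiPoly p ((-x : ℝ) : ℂ)‖ := by
  have hb := norm_leadingCoeff_pos p hp
  set b := p.leadingCoeff with hbd
  obtain ⟨K, hK0, hK⟩ := exists_norm_eval_sub_leading_le p le_rfl (ε := ‖b‖ / 2) (by positivity)
  filter_upwards [(Real.tendsto_exp_div_pow_atTop 2).eventually_ge_atTop (8 / ‖b‖),
    eventually_ge_atTop (1 + K)] with x hx hxK
  set w : ℂ := ((-x : ℝ) : ℂ) with hw
  have hx0 : 0 < x := by linarith
  rw [div_le_div_iff₀ hb (by positivity)] at hx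
  have h1 := hK (Complex.exp (-w))
  change _ ≤ ‖b‖ / 2 * scale p w + K at h1
  have h2 : ‖b‖ * scale p w ≤ ‖b‖ / 2 * scale p w + K + ‖quasiPoly p w‖ + x := by
    have e1 : b * Complex.exp (-w) ^ p.natDegree =
        -(p.eval (Complex.exp (-w)) - b * Complex.exp (-w) ^ p.natDegree) -
          quasiPoly p w + w := by
      rw [quasiPoly]; ring
    have e2 : ‖b * Complex.exp (-w) ^ p.natDegree‖ = ‖b‖ * scale p w := by
      rw [norm_mul, norm_pow]; rfl
    have e3 : ‖w‖ = x := by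
      rw [hw, Complex.norm_real, norm_neg, Real.norm_of_nonneg hx0.le]
    rw [← e2, e1]
    refine (norm_add_le _ _).trans ?_
    rw [e3]
    gcongr
    refine (norm_sub_le _ _).trans ?_
    rw [norm_neg]
    gcongr
    exact h1
  have h3 : Real.exp x ≤ scale p w := by
    rw [scale_eq, hw, Complex.ofReal_re]
    have : (1 : ℝ) ≤ p.natDegree := by exact_mod_cast hp
    gcongr
    nlinarith
  have h4 : ‖b‖ * Real.exp x ≤ ‖b‖ * scale p w := by gcongr
  nlinarith

theorem infinite_zeroSet {p : ℂ[X]} (hp : 1 ≤ p.natDegree) (hs : SimpleZeros p) :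
    (zeroSet p).Infinite := by
  intro hfin
  have := hfin.fintype
  have hofReal : Tendsto (fun x : ℝ => (x : ℂ)) atTop (Bornology.cobounded ℂ) := by
    rw [← tendsto_norm_atTop_iff_cobounded]
    simpa using tendsto_abs_atTop_atTop
  have hneg : Tendsto (fun x : ℝ => ((-x : ℝ) : ℂ)) atTop (Bornology.cobounded ℂ) := by
    rw [← tendsto_norm_atTop_iff_cobounded]
    simpa using tendsto_abs_atTop_atTop
  have hquot : Tendsto (fun x : ℝ => quasiPoly p x / x) atTop (𝓝 1) := by
    have h1 : Tendsto (fun x : ℝ => Complex.exp (-(x : ℂ))) atTop (𝓝 0) := by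
      rw [tendsto_zero_iff_norm_tendsto_zero]
      simpa [Complex.norm_exp] using Real.tendsto_exp_neg_atTop_nhds_zero
    have h2 := (p.continuous.tendsto 0).comp h1
    have h3 := (h2.mul (tendsto_inv₀_cobounded.comp hofReal)).const_sub 1
    rw [mul_zero, sub_zero] at h3
    refine h3.congr' ?_
    filter_upwards [eventually_gt_atTop 0] with x hx
    have : (x : ℂ) ≠ 0 := by exact_mod_cast hx.ne'
    simp only [Function.comp, quasiPoly]
    field_simp
  have e1 : (1 : ℂ) = ∑ v : zeroSet p, (quasiPolyDeriv p v)⁻¹ := by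
    refine tendsto_mul_inv_quasiPoly_unique hp hs (l := map (fun x : ℝ => (x : ℂ)) atTop)
      hofReal ?_ ?_
    · rw [eventually_map]
      filter_upwards [hquot.eventually_ne one_ne_zero] with x hx h0
      simp [h0] at hx
    · rw [tendsto_map'_iff]
      have := hquot.inv₀ one_ne_zero
      rw [inv_one] at this
      refine this.congr fun x => ?_
      simp [div_eq_mul_inv]
  have e2 : (0 : ℂ) = ∑ v : zeroSet p, (quasiPolyDeriv p v)⁻¹ := by
    refine tendsto_mul_inv_quasiPoly_unique hp hs (l := map (fun x : ℝ => ((-x : ℝ) : ℂ)) atTop)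
      hneg ?_ ?_
    · rw [eventually_map]
      filter_upwards [exists_norm_quasiPoly_ge p hp, eventually_gt_atTop 0] with x hx hx0 h0
      rw [h0, norm_zero] at hx
      nlinarith
    · rw [tendsto_map'_iff]
      refine squeeze_zero_norm' ?_ tendsto_inv_atTop_zero
      filter_upwards [exists_norm_quasiPoly_ge p hp, eventually_gt_atTop 0] with x hx hx0
      simp only [Function.comp]
      rw [norm_mul, norm_inv, Complex.norm_real, norm_neg, Real.norm_of_nonneg hx0.le]
      calc x * ‖quasiPoly p ((-x : ℝ) : ℂ)‖⁻¹ ≤ x * (x ^ 2)⁻¹ := by gcongr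
        _ = x⁻¹ := by field_simp
  exact one_ne_zero (e1.trans e2.symm)

/-! ### Injectivity of `w e^w` on the branch ranges -/

/-- This turns `w e^w = z` into two real equations: `Re w + log |w| = log |z|`, and `Im w + arg w =
arg z` modulo `2π`. A branch range fixes the multiple of `2π`, apart from the half line `(-∞, -1]`.
-/
theorem exp_add_log {w : ℂ} (hw : w ≠ 0) :
    Complex.exp (w + Complex.log w) = w * Complex.exp w := by
  rw [Complex.exp_add, Complex.exp_log hw, mul_comm]

theorem im_add_arg_pos {w : ℂ} (h : 0 < w.im) : 0 < w.im + w.arg :=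
  add_pos_of_pos_of_nonneg h (Complex.arg_nonneg_iff.2 h.le)

theorem im_add_arg_neg {w : ℂ} (h : w.im < 0) : w.im + w.arg < 0 :=
  add_neg h (Complex.arg_neg_iff.2 h)

theorem im_add_arg_of_real_pos {w : ℂ} (h : w.im = 0) (h' : 0 < w.re) : w.im + w.arg = 0 := by
  rw [h, Complex.arg_eq_zero_iff.2 ⟨h'.le, h⟩, add_zero]

theorem im_add_arg_of_real_neg {w : ℂ} (h : w.im = 0) (h' : w.re < 0) :
    w.im + w.arg = Real.pi := by
  rw [h, Complex.arg_eq_pi_iff.2 ⟨h', h⟩, zero_add]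

theorem im_add_arg_conj {w : ℂ} (h : w.im ≠ 0) :
    (star w).im + (star w).arg = -(w.im + w.arg) := by
  have : w.arg ≠ Real.pi := fun h' => h (Complex.arg_eq_pi_iff.1 h').2
  rw [Complex.star_def, Complex.conj_im, Complex.arg_conj, if_neg this]
  ring

theorem norm_of_im_eq_zero {w : ℂ} (h : w.im = 0) : ‖w‖ = |w.re| := by
  rw [← Complex.re_add_im w, h]
  simp

/-- `|w e^w| > e⁻¹` on the part of the curve `Im w + arg w = π` in the open upper half plane. -/
theorem neg_one_lt_re_add_log {w : ℂ} (h : 0 < w.im) (hπ : w.im + w.arg = Real.pi) :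
    -1 < w.re + Real.log ‖w‖ := by
  have hw : w ≠ 0 := by rintro rfl; simp at h
  have hr : 0 < ‖w‖ := norm_pos_iff.2 hw
  have harg : w.arg = Real.pi - w.im := by linarith
  have hs := Complex.sin_arg w
  have hc := Complex.cos_arg hw
  rw [harg, Real.sin_pi_sub] at hs
  rw [harg, Real.cos_pi_sub] at hc
  rw [eq_div_iff hr.ne'] at hs hc
  have hlt := Real.sin_lt h
  -- With `η = Im w`, the curve gives `|w| sin η = η` and `Re w = -|w| cos η`; then `sin η < η`
  -- forces `|w| > 1`.
  have hr1 : 1 < ‖w‖ := by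
    by_contra hle
    have hsp : 0 < Real.sin w.im := by
      by_contra hneg
      nlinarith
    nlinarith
  have hlog := Real.log_pos hr1
  -- Either `Re w ≥ 0`, or `η < π/2` and `η < tan η` gives `|w| cos η < 1`.
  rcases le_or_gt (Real.cos w.im) 0 with hcos | hcos
  · nlinarith
  · have hlt2 : w.im < Real.pi / 2 := by
      by_contra hge
      have h2 : w.im ≤ Real.pi := by
        have := Complex.arg_nonneg_iff.2 h.le
        linarith
      exact absurd (Real.cos_nonpos_of_pi_div_two_le_of_le (not_lt.1 hge) (by linarith)) hcos.not_ge
    have ht := Real.lt_tan h hlt2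
    rw [Real.tan_eq_sin_div_cos, lt_div_iff₀ hcos] at ht
    have : ‖w‖ * Real.cos w.im < 1 := by
      by_contra hge
      have : Real.sin w.im ≤ Real.sin w.im * (‖w‖ * Real.cos w.im) := by
        have hsp : 0 < Real.sin w.im := Real.sin_pos_of_pos_of_lt_pi h (by linarith [Real.pi_pos])
        nlinarith
      nlinarith
    linarith

/-- The derivative `1 + 1/w`, multiplied by `σ i`, has real part `σ Im w / |w|²`, positive on the
half plane. -/
theorem injOn_add_log {σ : ℝ} :
    Set.InjOn (fun w : ℂ => w + Complex.log w) {w : ℂ | 0 < σ * w.im} := by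
  have hconv : Convex ℝ {w : ℂ | 0 < σ * w.im} := by
    have : IsLinearMap ℝ fun w : ℂ => σ * w.im :=
      ⟨fun x y => by simp [mul_add], fun c x => by simp; ring⟩
    exact convex_halfSpace_gt this 0
  refine injOn_of_re_deriv_pos hconv (f' := fun w => 1 + w⁻¹) (fun z hz => ?_)
    (σ * Complex.I) (fun z hz => ?_)
  · have hz' : z.im ≠ 0 := by rintro h; simp [h] at hz
    exact (hasDerivAt_id z).add (Complex.hasDerivAt_log (Or.inr hz'))
  · have hz0 : z ≠ 0 := by rintro rfl; simp at hz
    have h1 : ((σ : ℂ) * Complex.I * (1 + z⁻¹)).re = σ * z.im / Complex.normSq z := by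
      rw [mul_assoc, Complex.re_ofReal_mul]
      simp [Complex.inv_im]
      ring
    rw [h1]
    exact div_pos hz (Complex.normSq_pos.2 hz0)

/-- `log x - x` is strictly monotone on each side of `1`, seen from `log t < t - 1` for a ratio `t ≠
1`. -/
theorem eq_of_log_sub_eq {x y : ℝ} (hx : 0 < x) (hy : 0 < y)
    (hxy : x ≤ 1 ∧ y ≤ 1 ∨ 1 ≤ x ∧ 1 ≤ y) (h : Real.log x - x = Real.log y - y) : x = y := by
  wlog hlt : x < y generalizing x y
  · rcases eq_or_lt_of_le (not_lt.1 hlt) with h' | h'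
    · exact h'.symm
    · exact (this hy hx (hxy.imp And.symm And.symm) h.symm h').symm
  exfalso
  rcases hxy with ⟨-, h1⟩ | ⟨h1, -⟩
  · have h2 := Real.log_lt_sub_one_of_pos (div_pos hx hy)
      (by rw [Ne, div_eq_one_iff_eq hy.ne']; exact hlt.ne)
    rw [Real.log_div hx.ne' hy.ne'] at h2
    have h3 : x / y - 1 = (x - y) / y := by field_simp
    have h4 : x - y < (x - y) / y := by linarith
    rw [lt_div_iff₀ hy] at h4
    nlinarith
  · have h2 := Real.log_lt_sub_one_of_pos (div_pos hy hx)
      (by rw [Ne, div_eq_one_iff_eq hx.ne']; exact hlt.ne')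
    rw [Real.log_div hy.ne' hx.ne'] at h2
    have h3 : y / x - 1 = (y - x) / x := by field_simp
    have h4 : y - x < (y - x) / x := by linarith
    rw [lt_div_iff₀ hx] at h4
    nlinarith

theorem eq_of_real_of_re_eq {v w : ℂ} (hv : v.im = 0) (hw : w.im = 0) (hv0 : v.re < 0)
    (hw0 : w.re < 0) (hvw : -1 ≤ v.re ∧ -1 ≤ w.re ∨ v.re ≤ -1 ∧ w.re ≤ -1)
    (h : v.re + Real.log ‖v‖ = w.re + Real.log ‖w‖) : v = w := by
  rw [norm_of_im_eq_zero hv, norm_of_im_eq_zero hw, Real.log_abs, Real.log_abs,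
    ← Real.log_neg_eq_log v.re, ← Real.log_neg_eq_log w.re] at h
  have := eq_of_log_sub_eq (neg_pos.2 hv0) (neg_pos.2 hw0)
    (hvw.imp (fun h => ⟨by linarith [h.1], by linarith [h.2]⟩)
      fun h => ⟨by linarith [h.1], by linarith [h.2]⟩) (by linarith)
  exact Complex.ext (neg_inj.1 this) (hv.trans hw.symm)

/-- `Re w + log |w| ≤ -1` on the negative half line. -/
theorem re_add_log_le_of_neg {w : ℂ} (h : w.im = 0) (h' : w.re < 0) :
    w.re + Real.log ‖w‖ ≤ -1 := by
  rw [norm_of_im_eq_zero h, abs_of_neg h']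
  have := Real.log_le_sub_one_of_pos (neg_pos.2 h')
  linarith

theorem re_pos_or_neg {w : ℂ} (hw : w ≠ 0) (h : w.im = 0) : 0 < w.re ∨ w.re < 0 := by
  rcases lt_trichotomy w.re 0 with h' | h' | h'
  · exact Or.inr h'
  · exact absurd (Complex.ext h' h) hw
  · exact Or.inl h'

theorem not_real_left_of_im_pos {v w : ℂ} (hv0 : v ≠ 0) (hv : v.im = 0) (hw : 0 < w.im)
    (hre : v.re + Real.log ‖v‖ = w.re + Real.log ‖w‖)
    (him : v.im + v.arg = w.im + w.arg) : False := by
  have h1 := im_add_arg_pos hw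
  rcases re_pos_or_neg hv0 hv with h | h
  · have := im_add_arg_of_real_pos hv h
    linarith
  · have h2 := im_add_arg_of_real_neg hv h
    have h3 := neg_one_lt_re_add_log hw (him.symm.trans h2)
    have h4 := re_add_log_le_of_neg hv h
    linarith

theorem not_real_left_of_im_neg {v w : ℂ} (hv0 : v ≠ 0) (hv : v.im = 0) (hw : w.im < 0)
    (him : v.im + v.arg = w.im + w.arg) : False := by
  have h1 := im_add_arg_neg hw
  rcases re_pos_or_neg hv0 hv with h | h
  · have := im_add_arg_of_real_pos hv h
    linarith
  · have := im_add_arg_of_real_neg hv h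
    linarith [Real.pi_pos]

/-- The sign of `Im w` is read off from `Im w + arg w`, except that the value `π` occurs both on the
negative axis and on a curve in the upper half plane. There `|w e^w|` decides: at most `1/e` on the
axis, greater on the curve. -/
theorem eq_of_add_log_eq {v w : ℂ} (hv0 : v ≠ 0) (hw0 : w ≠ 0)
    (hre : v.re + Real.log ‖v‖ = w.re + Real.log ‖w‖)
    (him : v.im + v.arg = w.im + w.arg) (hv : ¬(v.im = 0 ∧ v.re < -1))
    (hw : ¬(w.im = 0 ∧ w.re < -1)) : v = w := by
  have hfull : v + Complex.log v = w + Complex.log w :=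
    Complex.ext (by simpa [Complex.log_re] using hre) (by simpa [Complex.log_im] using him)
  rcases lt_trichotomy v.im 0 with h1 | h1 | h1 <;> rcases lt_trichotomy w.im 0 with h2 | h2 | h2
  · exact injOn_add_log (σ := -1) (by simpa using h1) (by simpa using h2) hfull
  · exact (not_real_left_of_im_neg hw0 h2 h1 him.symm).elim
  · linarith [im_add_arg_neg h1, im_add_arg_pos h2]
  · exact (not_real_left_of_im_neg hv0 h1 h2 him).elim
  · rcases re_pos_or_neg hv0 h1 with h3 | h3 <;> rcases re_pos_or_neg hw0 h2 with h4 | h4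
    · rw [norm_of_im_eq_zero h1, norm_of_im_eq_zero h2, abs_of_pos h3, abs_of_pos h4] at hre
      refine Complex.ext ?_ (h1.trans h2.symm)
      rcases lt_trichotomy v.re w.re with h | h | h
      · linarith [Real.log_lt_log h3 h]
      · exact h
      · linarith [Real.log_lt_log h4 h]
    · linarith [im_add_arg_of_real_pos h1 h3, im_add_arg_of_real_neg h2 h4, Real.pi_pos]
    · linarith [im_add_arg_of_real_neg h1 h3, im_add_arg_of_real_pos h2 h4, Real.pi_pos]
    · exact eq_of_real_of_re_eq h1 h2 h3 h4
        (Or.inl ⟨not_lt.1 fun h => hv ⟨h1, h⟩, not_lt.1 fun h => hw ⟨h2, h⟩⟩) hre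
  · exact (not_real_left_of_im_pos hv0 h1 h2 hre him).elim
  · linarith [im_add_arg_pos h1, im_add_arg_neg h2]
  · exact (not_real_left_of_im_pos hw0 h2 h1 hre.symm him.symm).elim
  · exact injOn_add_log (σ := 1) (by simpa using h1) (by simpa using h2) hfull

theorem add_log_eq_of_mul_exp_eq {v w : ℂ} (hv0 : v ≠ 0) (hw0 : w ≠ 0)
    (h : v * Complex.exp v = w * Complex.exp w) :
    v.re + Real.log ‖v‖ = w.re + Real.log ‖w‖ ∧
      ∃ n : ℤ, v.im + v.arg = w.im + w.arg + n * (2 * Real.pi) := by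
  rw [← exp_add_log hv0, ← exp_add_log hw0, Complex.exp_eq_exp_iff_exists_int] at h
  obtain ⟨n, hn⟩ := h
  constructor
  · simpa [Complex.log_re] using congrArg Complex.re hn
  · exact ⟨n, by simpa [Complex.log_im] using congrArg Complex.im hn⟩

/-- The half line has `Im + arg = π`, outside the window `(-3π, -π]` of the branch `-1`. Equality
would put `w` on the curve with value `-π`, the conjugate of the curve for `π`, where `|w e^w| >
1/e`. -/
theorem not_cut_of_mem_range {v w : ℂ} (hw0 : w ≠ 0) (hv : v.im = 0) (hv1 : v.re ≤ -1)
    (hw1 : (2 * ((-1 : ℤ) : ℝ) - 1) * Real.pi < w.im + w.arg)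
    (hw2 : w.im + w.arg ≤ (2 * ((-1 : ℤ) : ℝ) + 1) * Real.pi)
    (h : v * Complex.exp v = w * Complex.exp w) : False := by
  have hv0 : v ≠ 0 := by rintro rfl; norm_num at hv1
  obtain ⟨hre, n, hn⟩ := add_log_eq_of_mul_exp_eq hv0 hw0 h
  rw [im_add_arg_of_real_neg hv (by linarith)] at hn
  push_cast at hw1 hw2
  have hπ := Real.pi_pos
  have hn1 : n = 1 := by
    have h1 : (0 : ℝ) < n := by by_contra hle; nlinarith [not_lt.1 hle]
    have h2 : (n : ℝ) < 2 := by by_contra hle; nlinarith [not_lt.1 hle]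
    have h1' : 0 < n := by exact_mod_cast h1
    have h2' : n < 2 := by exact_mod_cast h2
    omega
  rw [hn1] at hn
  push_cast at hn
  have him : w.im < 0 := by
    by_contra hge
    have := Complex.arg_nonneg_iff.2 (not_lt.1 hge)
    linarith
  have h3 := neg_one_lt_re_add_log (w := star w) (by simpa using him)
    (by rw [im_add_arg_conj him.ne]; linarith)
  rw [norm_star, Complex.star_def, Complex.conj_re] at h3
  have h4 := re_add_log_le_of_neg hv (by linarith)
  linarith

theorem injOn_mul_exp_lambertRange (k : ℤ) :
    Set.InjOn (fun w : ℂ => w * Complex.exp w) (lambertRange k) := by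
  intro v hv w hw h
  change v * Complex.exp v = w * Complex.exp w at h
  by_cases hv0 : v = 0
  · subst hv0
    rw [zero_mul] at h
    exact ((mul_eq_zero.1 h.symm).resolve_right (Complex.exp_ne_zero w)).symm
  have hw0 : w ≠ 0 := by
    rintro rfl
    rw [zero_mul] at h
    exact hv0 ((mul_eq_zero.1 h).resolve_right (Complex.exp_ne_zero v))
  have hπ := Real.pi_pos
  rcases hv with ⟨hv1, hv2, hv3⟩ | ⟨hk, hv1, hv2⟩ <;>
    rcases hw with ⟨hw1, hw2, hw3⟩ | ⟨hk', hw1, hw2⟩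
  · obtain ⟨hre, n, hn⟩ := add_log_eq_of_mul_exp_eq hv0 hw0 h
    have hn1 : n = 0 := by
      have h1 : (-1 : ℝ) < n := by by_contra hle; nlinarith [not_lt.1 hle]
      have h2 : (n : ℝ) < 1 := by by_contra hle; nlinarith [not_lt.1 hle]
      have h1' : -1 < n := by exact_mod_cast h1
      have h2' : n < 1 := by exact_mod_cast h2
      omega
    rw [hn1, Int.cast_zero, zero_mul, add_zero] at hn
    exact eq_of_add_log_eq hv0 hw0 hre hn hv3 hw3
  · subst hk'
    exact (not_cut_of_mem_range hv0 hw1 hw2 hv1 hv2 h.symm).elim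
  · subst hk
    exact (not_cut_of_mem_range hw0 hv1 hv2 hw1 hw2 h).elim
  · exact eq_of_real_of_re_eq hv1 hw1 (by linarith) (by linarith) (Or.inr ⟨hv2, hw2⟩)
      (add_log_eq_of_mul_exp_eq hv0 hw0 h).1

theorem exists_mem_lambertRange (w : ℂ) : ∃ k : ℤ, w ∈ lambertRange k := by
  by_cases hcut : w.im = 0 ∧ w.re < -1
  · exact ⟨-1, Or.inr ⟨rfl, hcut.1, hcut.2.le⟩⟩
  have hπ := Real.pi_pos
  -- Normalised so that the window for `k` becomes `k - 1 < x ≤ k`, that is, `k = ⌈x⌉`.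
  set x := ((w.im + w.arg) / Real.pi - 1) / 2 with hx
  have hθ : w.im + w.arg = (2 * x + 1) * Real.pi := by rw [hx]; field_simp; ring
  refine ⟨⌈x⌉, Or.inl ⟨?_, ?_, hcut⟩⟩ <;> rw [hθ]
  · have := Int.ceil_lt_add_one x
    gcongr
    linarith
  · gcongr
    exact Int.le_ceil x

/-! ### Every branch reaches every nonzero number -/

/-- The logarithm of `|w e^w|` on the curve `Im w + arg w = θ`, parametrised by `φ = arg w`. -/
def curveLog (θ φ : ℝ) : ℝ :=
  (θ - φ) / Real.sin φ * Real.cos φ + Real.log ((θ - φ) / Real.sin φ)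

theorem exists_lt_curveLog {θ : ℝ} (hθ : 0 < θ) (ρ : ℝ) :
    ∃ φ ∈ Set.Ioo 0 (min θ Real.pi), ρ < curveLog θ φ := by
  have hcos : Tendsto Real.cos (𝓝[>] 0) (𝓝 1) := by
    simpa using Real.continuous_cos.continuousWithinAt.tendsto (x := (0 : ℝ)) (s := Set.Ioi 0)
  have hsin : Tendsto Real.sin (𝓝[>] 0) (𝓝[>] 0) := by
    refine tendsto_nhdsWithin_iff.2 ⟨?_, ?_⟩
    · simpa using Real.continuous_sin.continuousWithinAt.tendsto (x := (0 : ℝ)) (s := Set.Ioi 0)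
    · filter_upwards [Ioo_mem_nhdsGT Real.pi_pos] with φ hφ
      exact Real.sin_pos_of_pos_of_lt_pi hφ.1 hφ.2
  have hsub : Tendsto (fun φ : ℝ => θ - φ) (𝓝[>] 0) (𝓝 θ) := by
    have h1 : ContinuousAt (fun φ : ℝ => θ - φ) 0 := by fun_prop
    simpa using h1.tendsto.mono_left (nhdsWithin_le_nhds (s := Set.Ioi 0))
  have hr : Tendsto (fun φ : ℝ => (θ - φ) / Real.sin φ) (𝓝[>] 0) atTop :=
    hsub.pos_mul_atTop hθ (tendsto_inv_nhdsGT_zero.comp hsin)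
  have hΨ : Tendsto (curveLog θ) (𝓝[>] 0) atTop :=
    (hr.atTop_mul_pos one_pos hcos).atTop_add_atTop (Real.tendsto_log_atTop.comp hr)
  have hmem : Set.Ioo 0 (min θ Real.pi) ∈ 𝓝[>] (0 : ℝ) := Ioo_mem_nhdsGT (lt_min hθ Real.pi_pos)
  obtain ⟨φ, h1, h2⟩ := ((hΨ.eventually_gt_atTop ρ).and hmem).exists
  exact ⟨φ, h2, h1⟩

/-- At the upper end of the curve: for `θ < π` the radius tends to `0`; for `θ > π` it tends to
infinity with cosine near `-1`, which beats the logarithm; for `θ = π` it tends to `1` and the value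
to `-1`, hence the restriction on `ρ`. -/
theorem exists_curveLog_lt {θ : ℝ} (hθ : 0 < θ) {ρ : ℝ} (h : θ = Real.pi → -1 < ρ) :
    ∃ φ ∈ Set.Ioo 0 (min θ Real.pi), curveLog θ φ < ρ := by
  have hmem : Set.Ioo 0 (min θ Real.pi) ∈ 𝓝[<] (min θ Real.pi) :=
    Ioo_mem_nhdsLT (lt_min hθ Real.pi_pos)
  suffices hev : ∀ᶠ φ in 𝓝[<] (min θ Real.pi), curveLog θ φ < ρ by
    obtain ⟨φ, h1, h2⟩ := (hev.and hmem).exists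
    exact ⟨φ, h2, h1⟩
  rcases lt_trichotomy θ Real.pi with hlt | heq | hgt
  · rw [min_eq_left hlt.le] at hmem ⊢
    have hsinθ : 0 < Real.sin θ := Real.sin_pos_of_pos_of_lt_pi hθ hlt
    have hr0 : Tendsto (fun φ : ℝ => (θ - φ) / Real.sin φ) (𝓝[<] θ) (𝓝 0) := by
      have : ContinuousAt (fun φ : ℝ => (θ - φ) / Real.sin φ) θ := by
        fun_prop (disch := exact hsinθ.ne')
      simpa using this.tendsto.mono_left nhdsWithin_le_nhds
    have hr : Tendsto (fun φ : ℝ => (θ - φ) / Real.sin φ) (𝓝[<] θ) (𝓝[>] 0) := by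
      refine tendsto_nhdsWithin_iff.2 ⟨hr0, ?_⟩
      filter_upwards [hmem] with φ hφ
      exact div_pos (sub_pos.2 hφ.2)
        (Real.sin_pos_of_pos_of_lt_pi hφ.1 (hφ.2.trans hlt))
    have hΨ : Tendsto (curveLog θ) (𝓝[<] θ) atBot :=
      (hr0.mul (Real.continuous_cos.continuousAt.tendsto.mono_left nhdsWithin_le_nhds)).add_atBot
        (Real.tendsto_log_nhdsGT_zero.comp hr)
    exact hΨ.eventually_lt_atBot ρ
  · subst heq
    rw [min_self]
    have hr : Tendsto (fun φ : ℝ => (Real.pi - φ) / Real.sin φ) (𝓝[<] Real.pi) (𝓝 1) := by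
      have h1 : ContinuousAt (fun φ : ℝ => (Real.sinc (Real.pi - φ))⁻¹) Real.pi := by
        refine ContinuousAt.inv₀ ?_ (by simp)
        exact (Real.continuous_sinc.comp (continuous_const.sub continuous_id)).continuousAt
      have h2 := h1.tendsto.mono_left (nhdsWithin_le_nhds (s := Set.Iio Real.pi))
      simp only [sub_self, Real.sinc_zero, inv_one] at h2
      refine h2.congr' ?_
      filter_upwards [self_mem_nhdsWithin] with φ hφ
      rw [Real.sinc_of_ne_zero (sub_pos.2 hφ).ne', Real.sin_pi_sub, inv_div]
    have hΨ : Tendsto (curveLog Real.pi) (𝓝[<] Real.pi) (𝓝 (1 * Real.cos Real.pi + Real.log 1)) :=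
      (hr.mul (Real.continuous_cos.continuousAt.tendsto.mono_left nhdsWithin_le_nhds)).add
        (hr.log one_ne_zero)
    simp only [Real.cos_pi, Real.log_one, one_mul, add_zero] at hΨ
    exact (tendsto_order.1 hΨ).2 ρ (h rfl)
  · rw [min_eq_right hgt.le] at hmem ⊢
    have hsin : Tendsto Real.sin (𝓝[<] Real.pi) (𝓝[>] 0) := by
      refine tendsto_nhdsWithin_iff.2 ⟨?_, ?_⟩
      · simpa using (Real.continuous_sin.continuousAt (x := Real.pi)).tendsto.mono_left
          (nhdsWithin_le_nhds (s := Set.Iio Real.pi))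
      · filter_upwards [hmem] with φ hφ
        exact Real.sin_pos_of_pos_of_lt_pi hφ.1 hφ.2
    have hsub : Tendsto (fun φ : ℝ => θ - φ) (𝓝[<] Real.pi) (𝓝 (θ - Real.pi)) :=
      (continuous_const.sub continuous_id).continuousAt.tendsto.mono_left nhdsWithin_le_nhds
    have hr : Tendsto (fun φ : ℝ => (θ - φ) / Real.sin φ) (𝓝[<] Real.pi) atTop :=
      hsub.pos_mul_atTop (sub_pos.2 hgt) (tendsto_inv_nhdsGT_zero.comp hsin)
    have hlog : Tendsto (fun x : ℝ => Real.log x / x) atTop (𝓝 0) :=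
      Real.isLittleO_log_id_atTop.tendsto_div_nhds_zero
    have hsum : Tendsto (fun φ : ℝ => Real.cos φ +
        Real.log ((θ - φ) / Real.sin φ) / ((θ - φ) / Real.sin φ)) (𝓝[<] Real.pi) (𝓝 (-1)) := by
      have := ((Real.continuous_cos.continuousAt (x := Real.pi)).tendsto.mono_left
        (nhdsWithin_le_nhds (s := Set.Iio Real.pi))).add (hlog.comp hr)
      simpa using this
    have hΨ : Tendsto (curveLog θ) (𝓝[<] Real.pi) atBot := by
      refine (hr.atTop_mul_neg (by norm_num) hsum).congr' ?_
      filter_upwards [hr.eventually_gt_atTop 0] with φ hφ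
      rw [curveLog, mul_add, mul_div_cancel₀ _ hφ.ne']
    exact hΨ.eventually_lt_atBot ρ

theorem exists_curveLog_eq {θ : ℝ} (hθ : 0 < θ) {ρ : ℝ} (h : θ = Real.pi → -1 < ρ) :
    ∃ φ ∈ Set.Ioo 0 (min θ Real.pi), curveLog θ φ = ρ := by
  obtain ⟨α, hα, hα'⟩ := exists_curveLog_lt hθ h
  obtain ⟨β, hβ, hβ'⟩ := exists_lt_curveLog hθ ρ
  refine isPreconnected_Ioo.intermediate_value hα hβ ?_ ⟨hα'.le, hβ'.le⟩
  intro φ hφ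
  have hs : Real.sin φ ≠ 0 :=
    (Real.sin_pos_of_pos_of_lt_pi hφ.1 (hφ.2.trans_le (min_le_right _ _))).ne'
  have hn : (θ - φ) / Real.sin φ ≠ 0 :=
    div_ne_zero (sub_pos.2 (hφ.2.trans_le (min_le_left _ _))).ne' hs
  refine ContinuousAt.continuousWithinAt ?_
  have h1 : ContinuousAt (fun φ : ℝ => (θ - φ) / Real.sin φ) φ := by
    fun_prop (disch := exact hs)
  exact (h1.mul Real.continuous_cos.continuousAt).add (h1.log hn)

theorem exists_im_pos_add_log_eq {θ : ℝ} (hθ : 0 < θ) {ρ : ℝ} (h : θ = Real.pi → -1 < ρ) :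
    ∃ w : ℂ, 0 < w.im ∧ w.re + Real.log ‖w‖ = ρ ∧ w.im + w.arg = θ := by
  obtain ⟨φ, hφ, hρ⟩ := exists_curveLog_eq hθ h
  have h1 : φ < θ := hφ.2.trans_le (min_le_left _ _)
  have h2 : φ < Real.pi := hφ.2.trans_le (min_le_right _ _)
  have hs := Real.sin_pos_of_pos_of_lt_pi hφ.1 h2
  set r := (θ - φ) / Real.sin φ with hr
  have hr0 : 0 < r := div_pos (sub_pos.2 h1) hs
  have hrs : r * Real.sin φ = θ - φ := by rw [hr]; field_simp
  have him : ((r : ℂ) * Complex.exp (φ * Complex.I)).im = θ - φ := by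
    rw [Complex.im_ofReal_mul, Complex.exp_ofReal_mul_I_im, hrs]
  refine ⟨r * Complex.exp (φ * Complex.I), ?_, ?_, ?_⟩
  · rw [him]; linarith
  · rw [Complex.re_ofReal_mul, Complex.exp_ofReal_mul_I_re, norm_mul,
      Complex.norm_exp_ofReal_mul_I, mul_one, Complex.norm_real, Real.norm_of_nonneg hr0.le]
    exact hρ
  · rw [him, Complex.exp_mul_I, Complex.arg_mul_cos_add_sin_mul_I hr0
      ⟨by linarith [hφ.1], h2.le⟩]
    ring

theorem mul_exp_eq_of_add_log {w z : ℂ} (hw : w ≠ 0) (hz : z ≠ 0)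
    (hre : w.re + Real.log ‖w‖ = Real.log ‖z‖) (n : ℤ)
    (him : w.im + w.arg = z.arg + n * (2 * Real.pi)) : w * Complex.exp w = z := by
  rw [← exp_add_log hw]
  refine Eq.trans ?_ (Complex.exp_log hz)
  rw [Complex.exp_eq_exp_iff_exists_int]
  refine ⟨n, Complex.ext ?_ ?_⟩
  · simpa [Complex.log_re] using hre
  · simpa [Complex.log_im] using him

theorem exists_log_sub_eq_of_le_one {ρ : ℝ} (hρ : ρ ≤ -1) :
    ∃ x : ℝ, 0 < x ∧ x ≤ 1 ∧ Real.log x - x = ρ := by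
  have hmem : Real.exp ρ ∈ Set.Ioc (0 : ℝ) 1 :=
    ⟨Real.exp_pos _, Real.exp_le_one_iff.2 (by linarith)⟩
  obtain ⟨x, hx, h⟩ := isPreconnected_Ioc.intermediate_value hmem
    (show (1 : ℝ) ∈ Set.Ioc (0 : ℝ) 1 by simp) (f := fun x => Real.log x - x)
    (fun x hx => ((Real.continuousAt_log hx.1.ne').sub continuousAt_id).continuousWithinAt)
    (show ρ ∈ Set.Icc _ _ by
      constructor
      · simp [(Real.exp_pos ρ).le]
      · simpa using hρ)
  exact ⟨x, hx.1, hx.2, h⟩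

theorem exists_log_sub_eq_of_one_le {ρ : ℝ} (hρ : ρ ≤ -1) :
    ∃ x : ℝ, 1 ≤ x ∧ Real.log x - x = ρ := by
  -- At this point `log 2 ≤ 1` and `log (-ρ) ≤ -ρ - 1` bring `log x - x` down to at most `ρ`.
  have hmem : -2 * ρ ∈ Set.Ici (1 : ℝ) := by simp only [Set.mem_Ici]; linarith
  have hlow : Real.log (-2 * ρ) - -2 * ρ ≤ ρ := by
    have h1 := Real.log_le_sub_one_of_pos (show 0 < -ρ by linarith)
    have h2 := Real.log_le_sub_one_of_pos (show (0 : ℝ) < 2 by norm_num)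
    rw [show -2 * ρ = 2 * -ρ by ring, Real.log_mul (by norm_num) (by linarith)]
    linarith
  obtain ⟨x, hx, h⟩ := isPreconnected_Ici.intermediate_value hmem
    (show (1 : ℝ) ∈ Set.Ici (1 : ℝ) by simp) (f := fun x => Real.log x - x)
    (fun x hx => ((Real.continuousAt_log (zero_lt_one.trans_le hx).ne').sub
      continuousAt_id).continuousWithinAt)
    (show ρ ∈ Set.Icc _ _ from ⟨hlow, by simpa using hρ⟩)
  exact ⟨x, hx, h⟩

theorem exists_add_log_eq (ρ : ℝ) : ∃ x : ℝ, 0 < x ∧ x + Real.log x = ρ := by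
  have hlow : Real.exp (min (ρ - 1) 0) + Real.log (Real.exp (min (ρ - 1) 0)) ≤ ρ := by
    rw [Real.log_exp]
    have h1 : Real.exp (min (ρ - 1) 0) ≤ 1 := Real.exp_le_one_iff.2 (min_le_right _ _)
    linarith [min_le_left (ρ - 1) 0]
  obtain ⟨x, hx, h⟩ := isPreconnected_Ioi.intermediate_value
    (show Real.exp (min (ρ - 1) 0) ∈ Set.Ioi (0 : ℝ) from Real.exp_pos _)
    (show Real.exp ρ ∈ Set.Ioi (0 : ℝ) from Real.exp_pos _) (f := fun x => x + Real.log x)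
    (fun x hx => (continuousAt_id.add (Real.continuousAt_log
      (Set.mem_Ioi.1 hx).ne')).continuousWithinAt)
    (show ρ ∈ Set.Icc _ _ from ⟨hlow, by simp [(Real.exp_pos ρ).le]⟩)
  exact ⟨x, hx, h⟩

theorem neg_ofReal_re_add_log (x : ℝ) :
    ((-x : ℝ) : ℂ).re + Real.log ‖((-x : ℝ) : ℂ)‖ = Real.log x - x := by
  rw [Complex.ofReal_re, Complex.norm_real, norm_neg, Real.norm_eq_abs, Real.log_abs]
  ring

/-- Every branch of the Lambert function is defined on all nonzero numbers. -/
theorem exists_lambertRange_mul_exp_eq {z : ℂ} (hz : z ≠ 0) (k : ℤ) :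
    ∃ w ∈ lambertRange k, w * Complex.exp w = z := by
  have hπ := Real.pi_pos
  have ha1 := Complex.neg_pi_lt_arg z
  have ha2 := Complex.arg_le_pi z
  obtain ⟨θ, hθ⟩ : ∃ θ : ℝ, θ = z.arg + k * (2 * Real.pi) := ⟨_, rfl⟩
  have hmain : ∀ w : ℂ, w ≠ 0 → w.re + Real.log ‖w‖ = Real.log ‖z‖ → w.im + w.arg = θ →
      ¬(w.im = 0 ∧ w.re < -1) → ∃ w ∈ lambertRange k, w * Complex.exp w = z := by
    intro w hw hre him hcut
    refine ⟨w, Or.inl ⟨?_, ?_, hcut⟩, mul_exp_eq_of_add_log hw hz hre k (him.trans hθ)⟩ <;>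
      rw [him, hθ] <;> linarith
  -- Positive `θ` is solved in the upper half plane, negative `θ` by conjugation, zero on the
  -- positive axis. For `θ = ±π` and `|z| ≤ 1/e` the curve is missed and the solution is negative
  -- real: in `[-1, 0)` for `π`, in `(-∞, -1]` for `-π`.
  rcases lt_trichotomy θ 0 with hneg | h0 | hpos
  · by_cases hex : -θ = Real.pi ∧ Real.log ‖z‖ ≤ -1
    · obtain ⟨x, hx, hxρ⟩ := exists_log_sub_eq_of_one_le hex.2
      have hk : k = -1 := by
        have h1 : (-2 : ℝ) < k := by by_contra hle; nlinarith [not_lt.1 hle, hex.1]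
        have h2 : (k : ℝ) < 0 := by by_contra hle; nlinarith [not_lt.1 hle, hex.1]
        have h1' : -2 < k := by exact_mod_cast h1
        have h2' : k < 0 := by exact_mod_cast h2
        omega
      have hre0 : ((-x : ℝ) : ℂ).re ≤ -1 := by rw [Complex.ofReal_re]; linarith
      -- A negative real has `Im + arg = π`, not `θ = -π`, so the multiple of `2π` is `k + 1`
      -- instead of `k`.
      refine ⟨((-x : ℝ) : ℂ), Or.inr ⟨hk, Complex.ofReal_im _, hre0⟩,
        mul_exp_eq_of_add_log (by exact_mod_cast (by linarith : -x < 0).ne) hz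
          ((neg_ofReal_re_add_log x).trans hxρ) (k + 1) ?_⟩
      rw [im_add_arg_of_real_neg (Complex.ofReal_im _) (by linarith)]
      push_cast
      linarith [hex.1]
    · obtain ⟨w, hw, hre, him⟩ := exists_im_pos_add_log_eq (θ := -θ) (neg_pos.2 hneg)
        (ρ := Real.log ‖z‖) (fun h => not_le.1 fun h' => hex ⟨h, h'⟩)
      have hw0 : w ≠ 0 := by rintro rfl; simp at hw
      refine hmain (star w) (by simpa using hw0) ?_ ?_ ?_
      · rw [norm_star, Complex.star_def, Complex.conj_re, hre]
      · rw [im_add_arg_conj hw.ne', him, neg_neg]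
      · rintro ⟨h, -⟩
        simp [hw.ne'] at h
  · obtain ⟨x, hx, hxρ⟩ := exists_add_log_eq (Real.log ‖z‖)
    refine hmain x (by exact_mod_cast hx.ne') ?_ ?_ ?_
    · rw [Complex.ofReal_re, Complex.norm_real, Real.norm_of_nonneg hx.le, hxρ]
    · rw [im_add_arg_of_real_pos (Complex.ofReal_im x) (by simpa using hx), h0]
    · rintro ⟨-, h⟩
      rw [Complex.ofReal_re] at h
      linarith
  · by_cases hex : θ = Real.pi ∧ Real.log ‖z‖ ≤ -1
    · obtain ⟨x, hx0, hx1, hxρ⟩ := exists_log_sub_eq_of_le_one hex.2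
      refine hmain ((-x : ℝ) : ℂ) (by exact_mod_cast (neg_neg_of_pos hx0).ne)
        ((neg_ofReal_re_add_log x).trans hxρ) ?_ ?_
      · rw [im_add_arg_of_real_neg (Complex.ofReal_im _) (by simpa using hx0), hex.1]
      · rintro ⟨-, h⟩
        rw [Complex.ofReal_re] at h
        linarith
    · obtain ⟨w, hw, hre, him⟩ := exists_im_pos_add_log_eq hpos
        (ρ := Real.log ‖z‖) (fun h => not_le.1 fun h' => hex ⟨h, h'⟩)
      have hw0 : w ≠ 0 := by rintro rfl; simp at hw
      exact hmain w hw0 hre him fun h => hw.ne' h.1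

theorem zero_mem_lambertRange : (0 : ℂ) ∈ lambertRange 0 := by
  refine Or.inl ⟨?_, ?_, ?_⟩ <;> simp [Real.pi_pos, Real.pi_pos.le]

theorem lambertW_mul_exp {k : ℤ} {z : ℂ} (h : k = 0 ∨ z ≠ 0) :
    lambertW k z * Complex.exp (lambertW k z) = z := by
  have hex : ∃ w ∈ lambertRange k, w * Complex.exp w = z := by
    by_cases hz : z = 0
    · obtain rfl := h.resolve_right (not_not.2 hz)
      exact ⟨0, zero_mem_lambertRange, by simp [hz]⟩
    · exact exists_lambertRange_mul_exp_eq hz k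
  rw [lambertW, dif_pos hex]
  exact hex.choose_spec.2

theorem lambertW_eq {k : ℤ} {w : ℂ} (hw : w ∈ lambertRange k) :
    lambertW k (w * Complex.exp w) = w := by
  have hex : ∃ v ∈ lambertRange k, v * Complex.exp v = w * Complex.exp w := ⟨w, hw, rfl⟩
  rw [lambertW, dif_pos hex]
  exact injOn_mul_exp_lambertRange k hex.choose_spec.1 hw hex.choose_spec.2

/-! ### Return to the characteristic function -/

/-- The polynomial `∑ a_{jd} h e^{-jah} X^j`. In the variable `w = (s - a) h` the characteristic
function becomes `h⁻¹` times its quasi-polynomial. -/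
def charPoly (N : ℕ) (a : ℝ) (A : ℕ → ℝ) (h : ℝ) : ℂ[X] :=
  ∑ j ∈ Finset.Icc 1 N, C ((A j : ℂ) * h * Complex.exp (-(j : ℂ) * a * h)) * X ^ j

theorem one_le_natDegree_charPoly {N : ℕ} (a : ℝ) {A : ℕ → ℝ} {h : ℝ} (hh : h ≠ 0)
    (hA : ∃ j ∈ Finset.Icc 1 N, A j ≠ 0) : 1 ≤ (charPoly N a A h).natDegree := by
  obtain ⟨j, hj, hAj⟩ := hA
  refine (Finset.mem_Icc.1 hj).1.trans (le_natDegree_of_ne_zero ?_)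
  rw [charPoly, finsetSum_coeff]
  simp_rw [coeff_C_mul, coeff_X_pow, mul_ite, mul_one, mul_zero]
  rw [Finset.sum_ite_eq, if_pos hj]
  simp [hAj, hh, Complex.exp_ne_zero]

theorem eval_charPoly (N : ℕ) (a : ℝ) (A : ℕ → ℝ) (h : ℝ) (s : ℂ) :
    (charPoly N a A h).eval (Complex.exp (-((s - a) * h))) =
      h * ∑ j ∈ Finset.Icc 1 N, (A j : ℂ) * Complex.exp (-(j : ℂ) * s * h) := by
  rw [charPoly, eval_finsetSum, Finset.mul_sum]
  refine Finset.sum_congr rfl fun j _ => ?_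
  rw [eval_C_mul, eval_X_pow, ← Complex.exp_nat_mul]
  have : Complex.exp (-(j : ℂ) * s * h) =
      Complex.exp (-(j : ℂ) * a * h) * Complex.exp (j * -((s - a) * h)) := by
    rw [← Complex.exp_add]; ring_nf
  rw [this]
  ring

theorem quasiPoly_charPoly (N : ℕ) (a : ℝ) (A : ℕ → ℝ) (h : ℝ) (s : ℂ) :
    quasiPoly (charPoly N a A h) ((s - a) * h) = h * charFn N a A h s := by
  rw [quasiPoly, eval_charPoly, charFn]
  ring

theorem quasiPolyDeriv_charPoly (N : ℕ) (a : ℝ) (A : ℕ → ℝ) (h : ℝ) (s : ℂ) :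
    quasiPolyDeriv (charPoly N a A h) ((s - a) * h) = coeffDenom N A h s := by
  rw [quasiPolyDeriv, coeffDenom, charPoly, derivative_sum, Finset.mul_sum, eval_finsetSum]
  congr 1
  refine Finset.sum_congr rfl fun j hj => ?_
  obtain ⟨i, rfl⟩ : ∃ i, j = i + 1 := ⟨j - 1, by have := (Finset.mem_Icc.1 hj).1; omega⟩
  rw [derivative_C_mul, derivative_X_pow]
  simp only [eval_mul, eval_X, eval_C, eval_pow, Nat.add_sub_cancel]
  have : Complex.exp (-((i + 1 : ℕ) : ℂ) * s * h) =
      Complex.exp (-((i + 1 : ℕ) : ℂ) * a * h) * Complex.exp (-((s - a) * h)) ^ (i + 1) := by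
    rw [← Complex.exp_nat_mul, ← Complex.exp_add]; ring_nf
  rw [this]
  ring

theorem lambertArg_eq (N : ℕ) (a : ℝ) (A : ℕ → ℝ) (h : ℝ) (s : ℂ) :
    lambertArg N a A h s = Complex.exp ((s - a) * h) *
      (charPoly N a A h).eval (Complex.exp (-((s - a) * h))) := by
  rw [lambertArg, charPoly, eval_finsetSum, Finset.mul_sum]
  refine Finset.sum_congr rfl fun j _ => ?_
  rw [eval_C_mul, eval_X_pow, ← Complex.exp_nat_mul]
  have : Complex.exp (-((j : ℂ) - 1) * (s - a) * h) =
      Complex.exp ((s - a) * h) * Complex.exp (j * -((s - a) * h)) := by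
    rw [← Complex.exp_add]; ring_nf
  rw [this]
  ring

/-- The two sides on the left differ by `h Δ(s)` times the nonvanishing `e^{(s-a)h}`. Both
directions of the Lambert description rest on this. -/
theorem lambertArg_eq_mul_exp_iff {N : ℕ} {a : ℝ} {A : ℕ → ℝ} {h : ℝ} (hh : h ≠ 0) (s : ℂ) :
    (s - a) * h * Complex.exp ((s - a) * h) = lambertArg N a A h s ↔ charFn N a A h s = 0 := by
  have h1 := quasiPoly_charPoly N a A h s
  rw [quasiPoly] at h1
  have hh' : (h : ℂ) ≠ 0 := by exact_mod_cast hh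
  rw [lambertArg_eq, mul_comm, mul_right_inj' (Complex.exp_ne_zero _), ← sub_eq_zero, h1,
    mul_eq_zero, or_iff_right hh']

theorem hasDerivAt_charFn {N : ℕ} {a : ℝ} {A : ℕ → ℝ} {h : ℝ} (hh : h ≠ 0) (s : ℂ) :
    HasDerivAt (charFn N a A h) (coeffDenom N A h s) s := by
  have hh' : (h : ℂ) ≠ 0 := by exact_mod_cast hh
  have h1 : HasDerivAt (fun s : ℂ => (s - a) * h) h s := by
    simpa using ((hasDerivAt_id s).sub_const (a : ℂ)).mul_const (h : ℂ)
  have h2 := ((hasDerivAt_quasiPoly (charPoly N a A h) ((s - a) * h)).comp s h1).const_mul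
    (h : ℂ)⁻¹
  rw [quasiPolyDeriv_charPoly] at h2
  refine (h2.congr_deriv (by field_simp)).congr_of_eventuallyEq (Eventually.of_forall fun z => ?_)
  simp only [Function.comp_apply]
  rw [quasiPoly_charPoly, inv_mul_cancel_left₀ hh']

/-- The affine change of variable `s ↦ (s - a) h`. -/
def scaleEquiv (a : ℝ) {h : ℝ} (hh : h ≠ 0) : ℂ ≃ ℂ where
  toFun s := (s - a) * h
  invFun w := w / h + a
  left_inv s := by
    have : (h : ℂ) ≠ 0 := by exact_mod_cast hh
    field_simp
    ring
  right_inv w := by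
    have : (h : ℂ) ≠ 0 := by exact_mod_cast hh
    field_simp
    ring

theorem scaleEquiv_mem_zeroSet_iff {N : ℕ} {a : ℝ} {A : ℕ → ℝ} {h : ℝ} (hh : h ≠ 0) (s : ℂ) :
    charFn N a A h s = 0 ↔ scaleEquiv a hh s ∈ zeroSet (charPoly N a A h) := by
  have hh' : (h : ℂ) ≠ 0 := by exact_mod_cast hh
  change _ ↔ quasiPoly (charPoly N a A h) ((s - a) * h) = 0
  rw [quasiPoly_charPoly, mul_eq_zero, or_iff_right hh']

/-- The zeros of the characteristic function correspond to those of the quasi-polynomial. -/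
def charZeroEquiv (N : ℕ) (a : ℝ) (A : ℕ → ℝ) {h : ℝ} (hh : h ≠ 0) :
    {z : ℂ // charFn N a A h z = 0} ≃ zeroSet (charPoly N a A h) :=
  (scaleEquiv a hh).subtypeEquiv (scaleEquiv_mem_zeroSet_iff hh)

theorem simpleZeros_charPoly {N : ℕ} {a : ℝ} {A : ℕ → ℝ} {h : ℝ} (hh : h ≠ 0)
    (hsimple : ∀ z : ℂ, charFn N a A h z = 0 → deriv (charFn N a A h) z ≠ 0) :
    SimpleZeros (charPoly N a A h) := by
  intro w hw
  obtain ⟨s, rfl⟩ := (scaleEquiv a hh).surjective w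
  have := hsimple s ((scaleEquiv_mem_zeroSet_iff hh s).2 hw)
  rw [(hasDerivAt_charFn hh s).deriv, ← quasiPolyDeriv_charPoly N a] at this
  exact this

theorem exists_enumeration {N : ℕ} {a : ℝ} {A : ℕ → ℝ} {h : ℝ} (hh : h ≠ 0)
    (hA : ∃ j ∈ Finset.Icc 1 N, A j ≠ 0) (hs : SimpleZeros (charPoly N a A h)) :
    ∃ S : ℤ → ℂ, Function.Injective S ∧ Set.range S = {z : ℂ | charFn N a A h z = 0} := by
  have := (countable_zeroSet hs).to_subtype
  have := (infinite_zeroSet (one_le_natDegree_charPoly a hh hA) hs).to_subtype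
  obtain ⟨_⟩ := nonempty_denumerable (zeroSet (charPoly N a A h))
  let e : ℤ ≃ {z : ℂ // charFn N a A h z = 0} :=
    (Denumerable.equiv₂ ℤ (zeroSet (charPoly N a A h))).trans (charZeroEquiv N a A hh).symm
  refine ⟨fun n => e n, Subtype.val_injective.comp e.injective, ?_⟩
  change Set.range (Subtype.val ∘ e) = _
  rw [e.surjective.range_comp]
  exact Subtype.range_val

theorem hasSum_charFn {N : ℕ} {a : ℝ} {A : ℕ → ℝ} {h : ℝ} (hh : h ≠ 0)
    (hA : ∃ j ∈ Finset.Icc 1 N, A j ≠ 0) (hs : SimpleZeros (charPoly N a A h)) {s : ℂ}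
    (hs0 : charFn N a A h s ≠ 0) :
    HasSum (fun z : {z : ℂ // charFn N a A h z = 0} => coeff N A h z / (s - z))
      (1 / charFn N a A h s) := by
  have hh' : (h : ℂ) ≠ 0 := by exact_mod_cast hh
  have hw : quasiPoly (charPoly N a A h) ((s - a) * h) ≠ 0 := by
    rw [quasiPoly_charPoly]; exact mul_ne_zero hh' hs0
  have h1 := (hasSum_partial_fractions (one_le_natDegree_charPoly a hh hA) hs hw).mul_left (h : ℂ)
  rw [← (charZeroEquiv N a A hh).hasSum_iff, quasiPoly_charPoly] at h1
  have hval : (h : ℂ) * (h * charFn N a A h s)⁻¹ = 1 / charFn N a A h s := by field_simp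
  rw [hval] at h1
  refine Eq.mp (congrArg (HasSum · _) (funext fun z => ?_)) h1
  symm
  change _ = (h : ℂ) * ((quasiPolyDeriv (charPoly N a A h) ((z - a) * h))⁻¹ /
    ((s - a) * h - (z - a) * h))
  rw [quasiPolyDeriv_charPoly, coeff, ← sub_mul, sub_sub_sub_cancel_right, one_div,
    div_mul_eq_div_div, mul_div_cancel₀ _ hh']

theorem tendsto_residue {f : ℂ → ℂ} {d z : ℂ} (hf : HasDerivAt f d z) (hz : f z = 0) (hd : d ≠ 0) :
    Tendsto (fun s => (s - z) * (1 / f s)) (𝓝[≠] z) (𝓝 (1 / d)) := by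
  have h1 := (hasDerivAt_iff_tendsto_slope.1 hf).inv₀ hd
  rw [← one_div] at h1
  refine h1.congr fun s => ?_
  rw [slope_def_field, hz, sub_zero, inv_div, mul_one_div]

end MultiDelay

end

theorem mainTheorem3 (N : ℕ) (a : ℝ) (A : ℕ → ℝ) (h : ℝ) (hh : h ≠ 0)
    (hA : ∃ j ∈ Finset.Icc 1 N, A j ≠ 0)
    (hsimple : ∀ z : ℂ, MultiDelay.charFn N a A h z = 0 →
      deriv (MultiDelay.charFn N a A h) z ≠ 0) :
    (∃ S : ℤ → ℂ, Function.Injective S ∧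
      Set.range S = {z : ℂ | MultiDelay.charFn N a A h z = 0}) ∧
    ∀ S : ℤ → ℂ, Function.Injective S →
      Set.range S = {z : ℂ | MultiDelay.charFn N a A h z = 0} →
      -- every root is given by the branch (or branches) of the Lambert W function it belongs to
      (∀ n : ℤ,
        (∃ k : ℤ, (S n - a) * h ∈ MultiDelay.lambertRange k) ∧
        ∀ k : ℤ, (S n - a) * h ∈ MultiDelay.lambertRange k →
          S n = 1 / (h : ℂ) * MultiDelay.lambertW k (MultiDelay.lambertArg N a A h (S n)) + a) ∧
      -- every solution of the Lambert W equation is one of the roots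
      (∀ (z : ℂ) (k : ℤ), (k = 0 ∨ MultiDelay.lambertArg N a A h z ≠ 0) →
        z = 1 / (h : ℂ) * MultiDelay.lambertW k (MultiDelay.lambertArg N a A h z) + a →
        ∃ n : ℤ, z = S n) ∧
      -- the coefficients are well defined, and they are the residues
      (∀ n : ℤ, MultiDelay.coeffDenom N A h (S n) ≠ 0 ∧
        Tendsto (fun s : ℂ => (s - S n) * (1 / MultiDelay.charFn N a A h s)) (𝓝[≠] (S n))
          (𝓝 (MultiDelay.coeff N A h (S n)))) ∧
      -- the expansion
      (∀ s : ℂ, MultiDelay.charFn N a A h s ≠ 0 →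
        HasSum (fun n : ℤ => MultiDelay.coeff N A h (S n) / (s - S n))
          (1 / MultiDelay.charFn N a A h s)) := by
  have hs := MultiDelay.simpleZeros_charPoly hh hsimple
  have hh' : (h : ℂ) ≠ 0 := by exact_mod_cast hh
  refine ⟨MultiDelay.exists_enumeration hh hA hs, fun S hS hrange => ?_⟩
  have hroot : ∀ n, MultiDelay.charFn N a A h (S n) = 0 := fun n =>
    hrange.subset (Set.mem_range_self n)
  refine ⟨fun n => ⟨MultiDelay.exists_mem_lambertRange _, fun k hk => ?_⟩, fun z k hk hz => ?_,
    fun n => ?_, fun s hs0 => ?_⟩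
  · rw [← (MultiDelay.lambertArg_eq_mul_exp_iff hh (S n)).2 (hroot n), MultiDelay.lambertW_eq hk]
    field_simp
    ring
  · have hW : (z - a) * h = MultiDelay.lambertW k (MultiDelay.lambertArg N a A h z) := by
      nth_rw 1 [hz]
      field_simp
      ring
    have h1 := MultiDelay.lambertW_mul_exp hk
    rw [← hW, MultiDelay.lambertArg_eq_mul_exp_iff hh] at h1
    obtain ⟨n, hn⟩ := hrange.superset h1
    exact ⟨n, hn.symm⟩
  · have hd := MultiDelay.hasDerivAt_charFn (N := N) (a := a) (A := A) hh (S n)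
    have hd0 : MultiDelay.coeffDenom N A h (S n) ≠ 0 := by
      rw [← hd.deriv]; exact hsimple _ (hroot n)
    exact ⟨hd0, MultiDelay.tendsto_residue hd (hroot n) hd0⟩
  -- `HasSum` is unconditional, so the sum over the set of roots transfers to any enumeration.
  · let e : ℤ ≃ {z : ℂ // MultiDelay.charFn N a A h z = 0} :=
      (Equiv.ofInjective S hS).trans (Equiv.setCongr hrange)
    exact (e.hasSum_iff.2 (MultiDelay.hasSum_charFn hh hA hs hs0) : _)
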